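/- Let $\mathrm{DCPO}$ be the category of pointed directed-complete partial orders (posets with a least element in which every directed subset has a supremum) and Scott-continuous maps, with its cartesian product and the trace $\mathrm{Tr}^U(f)(a)=\pi_1 f(a,\mu u.\,\pi_2 f(a,u))$ for $f:A\times U\to B\times U$, where $\mu$ denotes the least fixpoint. The category $\mathrm{Int}(\mathrm{DCPO})$ has as objects pairs $\binom XS$ of dcpos and as morphisms $\binom XS\to\binom YR$ the Scott-continuous maps $X\times R\to Y\times S$. The identity of $\binom XS$ is the identity map of $X\times S$. The composite of $\lambda:\binom XS\to\binom YR$ and $\mu:\binom YR\to\binom ZQ$ sends $(x,q)$ to $(z,s)$, where $(y,s)=\lambda(x,r)$, $(z,r')=\mu(y,q)$ and the output $r'\in R$ is fed back to the input $r$ by the trace. Its symmetric monoidal product is $\binom{X_1}{S_1}\otimes\binom{X_2}{S_2}=\binom{X_1\times X_2}{S_2\times S_1}$ (with parallel composition on morphisms), its unit object is $I=\binom 11$, and it is compact closed with $\binom XS^*=\binom SX$, the unit $\eta:I\to\binom XS\otimes\binom XS^*$ and counit $\varepsilon:\binom XS^*\otimes\binom XS\to I$ being carried by identity maps; hence it is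 traced. Write $\mathcal C=\mathrm{Int}(\mathrm{DCPO})$. A context for $A\to B$ is a morphism $\kappa:B\to A$ of $\mathcal C$. For $\kappa:B_1\otimes B_2\to A_1\otimes A_2$ and $\lambda:A_2\to B_2$ put $\lambda/\kappa=\mathrm{Tr}^{B_2}\big((\mathrm{id}_{A_1}\otimes\lambda)\circ\kappa\big):B_1\to A_1$, with the trace of $\mathcal C$ given by its compact closed structure; for $\lambda:A_1\to B_1$ define $\lambda\backslash\kappa:B_2\to A_2$ from this using the symmetry. An open game $\mathcal G:A\to B$ over $\mathcal C$ consists of a set $\Sigma_{\mathcal G}$, a function $\sigma\mapsto\mathcal G_\sigma$ from $\Sigma_{\mathcal G}$ to $\mathcal C(A,B)$, and a relation $|\mathcal G|\subseteq\Sigma_{\mathcal G}\times\mathcal C(B,A)$, whose instances are written $|\mathcal G|^\sigma_\kappa$. Open games are identified along bijections of the sets $\Sigma$ that are compatible with these data. The category $\mathrm{OG}(\mathcal C)$ has the objects of $\mathcal C$ and as morphisms the (identified) open games. For $\mathcal G:A\to B$ and $\mathcal H:B\to C$, composition is given by $\Sigma_{\mathcal H\circ\mathcal G}=\Sigma_{\mathcal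 G}\times\Sigma_{\mathcal H}$, $(\mathcal H\circ\mathcal G)_{\sigma,\tau}=\mathcal H_\tau\circ\mathcal G_\sigma$ and $|\mathcal H\circ\mathcal G|^{\sigma,\tau}_\kappa\iff|\mathcal G|^\sigma_{\kappa\circ\mathcal H_\tau}\wedge|\mathcal H|^\tau_{\mathcal G_\sigma\circ\kappa}$. The tensor product is that of $\mathcal C$ on objects, and on morphisms $\Sigma_{\mathcal G\otimes\mathcal H}=\Sigma_{\mathcal G}\times\Sigma_{\mathcal H}$, $(\mathcal G\otimes\mathcal H)_{\sigma,\tau}=\mathcal G_\sigma\otimes\mathcal H_\tau$ and $|\mathcal G\otimes\mathcal H|^{\sigma,\tau}_\kappa\iff|\mathcal G|^\sigma_{\mathcal H_\tau/\kappa}\wedge|\mathcal H|^\tau_{\mathcal G_\sigma\backslash\kappa}$. The zero-player functor $F:\mathcal C\to\mathrm{OG}(\mathcal C)$ is the identity on objects and sends $\lambda$ to the game with a single strategy profile, labelled by $\lambda$ and winning in every context. The identities, associators, unitors and symmetry of $\mathrm{OG}(\mathcal C)$ are the images under $F$ of those of $\mathcal C$. With this structure $\mathrm{OG}(\mathcal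 C)$ is a symmetric monoidal category. **Claim.** The symmetric monoidal category $\mathrm{OG}(\mathrm{Int}(\mathrm{DCPO}))$ is compact closed, with duals $F(A)^*=F(A^*)$, units $F(\eta_A)$ and counits $F(\varepsilon_A)$. -/

import Mathlib

open CategoryTheory MonoidalCategory

universe u

/-! ## Pointed directed-complete partial orders -/

section LeastFixpoint

variable {α β γ : Type u}

/-- The least fixpoint `μ x. f x`, as the supremum of the iterates `⊥, f ⊥, f (f ⊥), …`. -/
noncomputable def lfpDcpo [CompletePartialOrder α] (f : α → α) : α :=
  sSup (Set.range fun n : ℕ => f^[n] ⊥)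

theorem lfpDcpo_isLUB [CompletePartialOrder α] {f : α → α} (hf : Monotone f) :
    Monotone (fun n : ℕ => f^[n] ⊥) ∧
      IsLUB (Set.range fun n : ℕ => f^[n] ⊥) (lfpDcpo f) := by
  have hm : Monotone (fun n : ℕ => f^[n] ⊥) := by
    refine monotone_nat_of_le_succ fun n => ?_
    rw [Function.iterate_succ_apply]
    exact hf.iterate n bot_le
  exact ⟨hm, CompletePartialOrder.lubOfDirected _ (hm.directed_le.directedOn_range)⟩

theorem lfpDcpo_le [CompletePartialOrder α] {f : α → α} (hf : Monotone f) {a : α}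
    (h : f a ≤ a) : lfpDcpo f ≤ a := by
  refine (lfpDcpo_isLUB hf).2.2 ?_
  rintro _ ⟨n, rfl⟩
  induction n with
  | zero => exact bot_le
  | succ n ih =>
    simp only [Function.iterate_succ_apply']
    exact (hf ih).trans h

theorem lfpDcpo_eq [CompletePartialOrder α] {f : α → α} (hf : ScottContinuous f) :
    f (lfpDcpo f) = lfpDcpo f := by
  have hmono := hf.monotone
  obtain ⟨hm, hl⟩ := lfpDcpo_isLUB hmono
  refine le_antisymm ?_ (lfpDcpo_le hmono ?_)
  · refine (hf (Set.range_nonempty _) (hm.directed_le.directedOn_range) hl).2 ?_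
    rintro _ ⟨_, ⟨n, rfl⟩, rfl⟩
    exact hl.1 ⟨n + 1, Function.iterate_succ_apply' f n ⊥⟩
  · refine hmono ?_
    refine (hf (Set.range_nonempty _) (hm.directed_le.directedOn_range) hl).2 ?_
    rintro _ ⟨_, ⟨n, rfl⟩, rfl⟩
    exact hl.1 ⟨n + 1, Function.iterate_succ_apply' f n ⊥⟩

/-- The least fixpoint depends continuously on parameters. -/
theorem lfpDcpo_scottContinuous [Preorder α] [CompletePartialOrder β] {f : α × β → β}
    (hf : ScottContinuous f) : ScottContinuous fun a => lfpDcpo fun b => f (a, b) := by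
  have hfm := hf.monotone
  have hc : ∀ a, ScottContinuous fun b => f (a, b) := fun a =>
    ScottContinuous.comp ((ScottContinuous.const a).prodMk ScottContinuous.id) hf
  have hmono : Monotone fun a => lfpDcpo fun b => f (a, b) := by
    intro a a' h
    refine lfpDcpo_le (hc a).monotone ?_
    calc f (a, lfpDcpo fun b => f (a', b)) ≤ f (a', lfpDcpo fun b => f (a', b)) :=
          hfm ⟨h, le_rfl⟩
      _ = _ := lfpDcpo_eq (hc a')
  intro d hd hdir a ha
  refine ⟨?_, fun b hb => ?_⟩
  · rintro _ ⟨x, hx, rfl⟩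
    exact hmono (ha.1 hx)
  · have hdir' : DirectedOn (· ≤ ·) ((fun a => lfpDcpo fun b => f (a, b)) '' d) :=
      directedOn_image.2 fun x hx y hy => by
        obtain ⟨z, hz, h1, h2⟩ := hdir x hx y hy
        exact ⟨z, hz, hmono h1, hmono h2⟩
    set v := sSup ((fun a => lfpDcpo fun b => f (a, b)) '' d) with hv
    have hlub := CompletePartialOrder.lubOfDirected _ hdir'
    refine le_trans ?_ (hlub.2 hb)
    refine lfpDcpo_le (hc a).monotone ?_
    have hpair : IsLUB ((fun x => (x, lfpDcpo fun b => f (x, b))) '' d) (a, v) := by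
      rw [isLUB_prod, Set.image_image, Set.image_image]
      simpa using ⟨ha, hlub⟩
    have hdirp : DirectedOn (· ≤ ·) ((fun x => (x, lfpDcpo fun b => f (x, b))) '' d) :=
      directedOn_image.2 fun x hx y hy => by
        obtain ⟨z, hz, h1, h2⟩ := hdir x hx y hy
        exact ⟨z, hz, ⟨h1, hmono h1⟩, ⟨h2, hmono h2⟩⟩
    refine (hf (hd.image _) hdirp hpair).2 ?_
    rintro _ ⟨_, ⟨x, hx, rfl⟩, rfl⟩
    have : f (x, lfpDcpo fun b => f (x, b)) = lfpDcpo fun b => f (x, b) := lfpDcpo_eq (hc x)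
    simp only [this]
    exact hlub.1 ⟨x, hx, rfl⟩

end LeastFixpoint

/-- A pointed directed-complete partial order. -/
structure DCPO : Type (u + 1) where
  carrier : Type u
  [str : CompletePartialOrder carrier]

namespace DCPO

instance : CoeSort DCPO.{u} (Type u) := ⟨DCPO.carrier⟩

instance (X : DCPO.{u}) : CompletePartialOrder X := X.str

/-- Morphisms of dcpos are Scott-continuous maps (not required to preserve `⊥`). -/
@[ext]
structure Hom (X Y : DCPO.{u}) : Type u where
  toFun : X → Y
  cont : ScottContinuous toFun

instance : Category DCPO.{u} where
  Hom := Hom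
  id X := ⟨id, ScottContinuous.id⟩
  comp f g := ⟨g.toFun ∘ f.toFun, f.cont.comp g.cont⟩

/-- The cartesian product, ordered componentwise. -/
noncomputable def prod (X Y : DCPO.{u}) : DCPO.{u} where
  carrier := X × Y
  str :=
    { (inferInstance : PartialOrder (X × Y)), (inferInstance : OrderBot (X × Y)) with
      sSup := fun d => (sSup (Prod.fst '' d), sSup (Prod.snd '' d))
      lubOfDirected := fun d hd => by
        rw [isLUB_prod]
        refine ⟨CompletePartialOrder.lubOfDirected _ ?_, CompletePartialOrder.lubOfDirected _ ?_⟩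
        · exact directedOn_image.2 fun x hx y hy => by
            obtain ⟨z, hz, h1, h2⟩ := hd x hx y hy
            exact ⟨z, hz, h1.1, h2.1⟩
        · exact directedOn_image.2 fun x hx y hy => by
            obtain ⟨z, hz, h1, h2⟩ := hd x hx y hy
            exact ⟨z, hz, h1.2, h2.2⟩ }

/-- The terminal object, a one-point dcpo. -/
def one : DCPO.{u} where
  carrier := PUnit
  str :=
    { (inferInstance : PartialOrder PUnit), (inferInstance : OrderBot PUnit) with
      sSup := fun _ => PUnit.unit
      lubOfDirected := fun _ _ => ⟨fun _ _ => trivial, fun _ _ => trivial⟩ }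

/-- The trace of the traced cartesian category of dcpos: feed the output `U` back to the
input `U` by taking a least fixpoint. -/
noncomputable def trace {A B U : DCPO.{u}} (f : A.prod U ⟶ B.prod U) : A ⟶ B :=
  Hom.mk (fun a => (f.toFun (a, lfpDcpo fun u => (f.toFun (a, u)).2)).1) <| by
    have h2 : ScottContinuous fun p : A × U => (f.toFun p).2 := f.cont.comp ScottContinuous.snd
    have h1 : ScottContinuous fun p : A × U => (f.toFun p).1 := f.cont.comp ScottContinuous.fst
    exact (ScottContinuous.id.prodMk (lfpDcpo_scottContinuous h2)).comp h1

end DCPO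

/-! ## The category `Int(DCPO)` -/

/-- Objects of `Int(DCPO)`: pairs of dcpos. -/
structure IntDCPO : Type (u + 1) where
  pos : DCPO.{u}
  neg : DCPO.{u}

namespace IntDCPO

/-- A morphism `(X, S) ⟶ (Y, R)` of `Int(DCPO)` is a continuous map `X × R → Y × S`. -/
structure Hom (A B : IntDCPO.{u}) : Type u where
  map : A.pos.prod B.neg ⟶ B.pos.prod A.neg

/-- Build a morphism of `Int(DCPO)` from a Scott-continuous function. -/
def Hom.ofFun {A B : IntDCPO.{u}} (f : A.pos × B.neg → B.pos × A.neg) (hf : ScottContinuous f) :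
    Hom A B :=
  ⟨DCPO.Hom.mk f hf⟩

/-- The continuous function underlying a morphism of `Int(DCPO)`. -/
def Hom.fn {A B : IntDCPO.{u}} (f : Hom A B) : A.pos × B.neg → B.pos × A.neg := f.map.toFun

@[fun_prop]
theorem Hom.fn_cont {A B : IntDCPO.{u}} (f : Hom A B) : ScottContinuous f.fn := f.map.cont

/-- The morphism acting by `a` on the positive and by `b` on the negative part. -/
def Hom.wire {A B : IntDCPO.{u}} (a : A.pos → B.pos) (b : B.neg → A.neg)
    (ha : ScottContinuous a) (hb : ScottContinuous b) : Hom A B :=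
  .ofFun (fun p => (a p.1, b p.2))
    ((ScottContinuous.fst.comp ha).prodMk (ScottContinuous.snd.comp hb))

/-- The composite of `f : (X, S) ⟶ (Y, R)` and `g : (Y, R) ⟶ (Z, Q)`: the trace over `R` of the map
`(X × Q) × R → (Z × S) × R` that applies `f` to `X × R` and then `g` to `Y × Q`. -/
noncomputable def Hom.comp {A B C : IntDCPO.{u}} (f : Hom A B) (g : Hom B C) : Hom A C :=
  ⟨DCPO.trace (A := A.pos.prod C.neg) (B := C.pos.prod A.neg) (U := B.neg) <|
    DCPO.Hom.mk
      (fun p : (A.pos × C.neg) × B.neg =>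
        let ys := f.fn (p.1.1, p.2)
        let zr := g.fn (ys.1, p.1.2)
        (((zr.1, ys.2), zr.2) : (C.pos × A.neg) × B.neg))
      (by
        have hf : ScottContinuous fun p : (A.pos × C.neg) × B.neg => f.fn (p.1.1, p.2) :=
          ((ScottContinuous.fst.comp ScottContinuous.fst).prodMk ScottContinuous.snd).comp
            f.fn_cont
        have hg : ScottContinuous fun p : (A.pos × C.neg) × B.neg =>
            g.fn ((f.fn (p.1.1, p.2)).1, p.1.2) :=
          ((hf.comp ScottContinuous.fst).prodMk
            (ScottContinuous.fst.comp ScottContinuous.snd)).comp g.fn_cont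
        exact ((hg.comp ScottContinuous.fst).prodMk (hf.comp ScottContinuous.snd)).prodMk
          (hg.comp ScottContinuous.snd))⟩

/-- An auxiliary description of a morphism by the outputs that bound its values from above; it
turns composition into relational composition. -/
def Hom.Rel {A B : IntDCPO.{u}} (f : Hom A B) (x : A.pos) (r : B.neg) (y : B.pos) (s : A.neg) :
    Prop :=
  (f.fn (x, r)).1 ≤ y ∧ (f.fn (x, r)).2 ≤ s

theorem Hom.ext_rel {A B : IntDCPO.{u}} {f g : Hom A B}
    (h : ∀ x r y s, f.Rel x r y s ↔ g.Rel x r y s) : f = g := by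
  obtain ⟨⟨f, hf⟩⟩ := f
  obtain ⟨⟨g, hg⟩⟩ := g
  have : f = g := by
    funext ⟨x, r⟩
    have h1 := (h x r (f (x, r)).1 (f (x, r)).2).1 ⟨le_rfl, le_rfl⟩
    have h2 := (h x r (g (x, r)).1 (g (x, r)).2).2 ⟨le_rfl, le_rfl⟩
    exact Prod.ext (le_antisymm h2.1 h1.1) (le_antisymm h2.2 h1.2)
  subst this
  rfl

theorem Hom.Rel.mono {A B : IntDCPO.{u}} {f : Hom A B} {x x' : A.pos} {r r' : B.neg}
    {y y' : B.pos} {s s' : A.neg} (h : f.Rel x r y s) (hx : x' ≤ x) (hr : r' ≤ r)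
    (hy : y ≤ y') (hs : s ≤ s') : f.Rel x' r' y' s' := by
  have hm : f.fn (x', r') ≤ f.fn (x, r) := f.fn_cont.monotone ⟨hx, hr⟩
  exact ⟨(hm.1.trans h.1).trans hy, (hm.2.trans h.2).trans hs⟩

theorem Hom.rel_wire {A B : IntDCPO.{u}} {a : A.pos → B.pos} {b : B.neg → A.neg}
    {ha : ScottContinuous a} {hb : ScottContinuous b} {x : A.pos} {r : B.neg} {y : B.pos}
    {s : A.neg} : (Hom.wire a b ha hb).Rel x r y s ↔ a x ≤ y ∧ b r ≤ s := Iff.rfl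

theorem Hom.rel_comp {A B C : IntDCPO.{u}} {f : Hom A B} {g : Hom B C} {x : A.pos} {q : C.neg}
    {z : C.pos} {s : A.neg} :
    (f.comp g).Rel x q z s ↔ ∃ y r, f.Rel x r y s ∧ g.Rel y q z r := by
  have hc : ScottContinuous fun r : B.neg => (g.fn ((f.fn (x, r)).1, q)).2 := by
    have h1 : ScottContinuous fun r : B.neg => (f.fn (x, r)).1 :=
      ((((ScottContinuous.const x).prodMk ScottContinuous.id).comp f.fn_cont).comp
        ScottContinuous.fst)
    exact ((h1.prodMk (ScottContinuous.const q)).comp g.fn_cont).comp ScottContinuous.snd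
  constructor
  · intro h
    set r := lfpDcpo fun r : B.neg => (g.fn ((f.fn (x, r)).1, q)).2 with hr
    have he : (g.fn ((f.fn (x, r)).1, q)).2 = r := lfpDcpo_eq hc
    exact ⟨(f.fn (x, r)).1, r, ⟨le_rfl, h.2⟩, ⟨h.1, he.le⟩⟩
  · rintro ⟨y, r, hf, hg⟩
    have hr : (lfpDcpo fun r : B.neg => (g.fn ((f.fn (x, r)).1, q)).2) ≤ r := by
      refine lfpDcpo_le hc.monotone ?_
      exact ((g.fn_cont.monotone (a := ((f.fn (x, r)).1, q)) (b := (y, q)) ⟨hf.1, le_rfl⟩).2).trans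
        hg.2
    have hf' := hf.mono (le_refl x) hr le_rfl le_rfl
    have hg' := hg.mono hf'.1 (le_refl q) le_rfl le_rfl
    exact ⟨hg'.1, hf'.2⟩

noncomputable instance : Category IntDCPO.{u} where
  Hom := Hom
  id A := Hom.wire id id ScottContinuous.id ScottContinuous.id
  comp := Hom.comp
  id_comp f := Hom.ext_rel fun x r y s => by
    rw [Hom.rel_comp]
    exact ⟨fun ⟨_, _, ⟨h1, h2⟩, h3⟩ => h3.mono h1 le_rfl le_rfl h2,
      fun h => ⟨x, s, ⟨le_rfl, le_rfl⟩, h⟩⟩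
  comp_id f := Hom.ext_rel fun x r y s => by
    rw [Hom.rel_comp]
    exact ⟨fun ⟨_, _, h3, ⟨h1, h2⟩⟩ => h3.mono le_rfl h2 h1 le_rfl,
      fun h => ⟨y, r, h, ⟨le_rfl, le_rfl⟩⟩⟩
  assoc f g h := Hom.ext_rel fun x r y s => by
    simp only [Hom.rel_comp]
    exact ⟨fun ⟨a, b, ⟨c, d, h1, h2⟩, h3⟩ => ⟨c, d, h1, a, b, h2, h3⟩,
      fun ⟨c, d, h1, a, b, h2, h3⟩ => ⟨a, b, ⟨c, d, h1, h2⟩, h3⟩⟩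

/-- `(X₁, S₁) ⊗ (X₂, S₂) = (X₁ × X₂, S₂ × S₁)`. -/
noncomputable def tensorObj (A B : IntDCPO.{u}) : IntDCPO.{u} := ⟨A.pos.prod B.pos, B.neg.prod A.neg⟩

/-- Parallel composition of morphisms of `Int(DCPO)`. -/
noncomputable def Hom.tensor {A B A' B' : IntDCPO.{u}} (f : Hom A B) (g : Hom A' B') :
    Hom (tensorObj A A') (tensorObj B B') :=
  .ofFun
    (fun p : (A.pos × A'.pos) × (B'.neg × B.neg) =>
      let ys := f.fn (p.1.1, p.2.2)
      let ys' := g.fn (p.1.2, p.2.1)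
      (((ys.1, ys'.1), (ys'.2, ys.2)) : (B.pos × B'.pos) × (A'.neg × A.neg)))
    (by
      have hf : ScottContinuous fun p : (A.pos × A'.pos) × (B'.neg × B.neg) =>
          f.fn (p.1.1, p.2.2) :=
        ((ScottContinuous.fst.comp ScottContinuous.fst).prodMk
          (ScottContinuous.snd.comp ScottContinuous.snd)).comp f.fn_cont
      have hg : ScottContinuous fun p : (A.pos × A'.pos) × (B'.neg × B.neg) =>
          g.fn (p.1.2, p.2.1) :=
        ((ScottContinuous.fst.comp ScottContinuous.snd).prodMk
          (ScottContinuous.snd.comp ScottContinuous.fst)).comp g.fn_cont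
      exact ((hf.comp ScottContinuous.fst).prodMk (hg.comp ScottContinuous.fst)).prodMk
        ((hg.comp ScottContinuous.snd).prodMk (hf.comp ScottContinuous.snd)))

/-- The isomorphism of `Int(DCPO)` given by a bijective rewiring of both parts. -/
noncomputable def wireIso {A B : IntDCPO.{u}} (a : A.pos → B.pos) (a' : B.pos → A.pos)
    (b : A.neg → B.neg) (b' : B.neg → A.neg)
    (ha : ScottContinuous a) (ha' : ScottContinuous a')
    (hb : ScottContinuous b) (hb' : ScottContinuous b')
    (h1 : ∀ x, a' (a x) = x) (h2 : ∀ x, a (a' x) = x)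
    (h3 : ∀ x, b' (b x) = x) (h4 : ∀ x, b (b' x) = x) : A ≅ B where
  hom := Hom.wire a b' ha hb'
  inv := Hom.wire a' b ha' hb
  hom_inv_id := Hom.ext_rel fun x r y s => by
    refine Hom.rel_comp.trans ⟨fun ⟨c, d, ⟨h5, h6⟩, h7, h8⟩ => ⟨?_, ?_⟩, fun ⟨h5, h6⟩ =>
      ⟨a x, b r, ⟨le_rfl, ?_⟩, ?_, le_rfl⟩⟩
    · exact (h1 x).symm.le.trans ((ha'.monotone h5).trans h7)
    · exact (h3 r).symm.le.trans ((hb'.monotone h8).trans h6)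
    · exact (h3 r).le.trans h6
    · exact (h1 x).le.trans h5
  inv_hom_id := Hom.ext_rel fun x r y s => by
    refine Hom.rel_comp.trans ⟨fun ⟨c, d, ⟨h5, h6⟩, h7, h8⟩ => ⟨?_, ?_⟩, fun ⟨h5, h6⟩ =>
      ⟨a' x, b' r, ⟨le_rfl, ?_⟩, ?_, le_rfl⟩⟩
    · exact (h2 x).symm.le.trans ((ha.monotone h5).trans h7)
    · exact (h4 r).symm.le.trans ((hb.monotone h8).trans h6)
    · exact (h4 r).le.trans h6
    · exact (h2 x).le.trans h5

section
variable {α β γ : Type u} [Preorder α] [Preorder β] [Preorder γ]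

theorem scott_assoc : ScottContinuous fun p : (α × β) × γ => (p.1.1, (p.1.2, p.2)) :=
  (ScottContinuous.fst.comp ScottContinuous.fst).prodMk
    ((ScottContinuous.fst.comp ScottContinuous.snd).prodMk ScottContinuous.snd)

theorem scott_assoc_inv : ScottContinuous fun p : α × (β × γ) => ((p.1, p.2.1), p.2.2) :=
  (ScottContinuous.fst.prodMk (ScottContinuous.snd.comp ScottContinuous.fst)).prodMk
    (ScottContinuous.snd.comp ScottContinuous.snd)

theorem scott_swap : ScottContinuous fun p : α × β => (p.2, p.1) :=
  ScottContinuous.snd.prodMk ScottContinuous.fst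

end

noncomputable instance : MonoidalCategoryStruct IntDCPO.{u} where
  tensorObj := tensorObj
  tensorHom f g := Hom.tensor f g
  whiskerLeft A _ _ f := Hom.tensor (𝟙 A) f
  whiskerRight f A := Hom.tensor f (𝟙 A)
  tensorUnit := ⟨DCPO.one, DCPO.one⟩
  associator A B C :=
    wireIso (A := tensorObj (tensorObj A B) C) (B := tensorObj A (tensorObj B C))
      (fun p : (A.pos × B.pos) × C.pos => ((p.1.1, (p.1.2, p.2)) : A.pos × (B.pos × C.pos)))
      (fun p : A.pos × (B.pos × C.pos) => (((p.1, p.2.1), p.2.2) : (A.pos × B.pos) × C.pos))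
      (fun p : C.neg × (B.neg × A.neg) => (((p.1, p.2.1), p.2.2) : (C.neg × B.neg) × A.neg))
      (fun p : (C.neg × B.neg) × A.neg => ((p.1.1, (p.1.2, p.2)) : C.neg × (B.neg × A.neg)))
      scott_assoc scott_assoc_inv scott_assoc_inv scott_assoc
      (fun _ => rfl) (fun _ => rfl) (fun _ => rfl) (fun _ => rfl)
  leftUnitor A :=
    wireIso (A := tensorObj ⟨DCPO.one, DCPO.one⟩ A) (B := A)
      (fun p : PUnit × A.pos => p.2) (fun x => ((PUnit.unit, x) : PUnit × A.pos))
      (fun p : A.neg × PUnit => p.1) (fun x => ((x, PUnit.unit) : A.neg × PUnit))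
      ScottContinuous.snd ((ScottContinuous.const _).prodMk ScottContinuous.id)
      ScottContinuous.fst (ScottContinuous.id.prodMk (ScottContinuous.const _))
      (fun _ => rfl) (fun _ => rfl) (fun _ => rfl) (fun _ => rfl)
  rightUnitor A :=
    wireIso (A := tensorObj A ⟨DCPO.one, DCPO.one⟩) (B := A)
      (fun p : A.pos × PUnit => p.1) (fun x => ((x, PUnit.unit) : A.pos × PUnit))
      (fun p : PUnit × A.neg => p.2) (fun x => ((PUnit.unit, x) : PUnit × A.neg))
      ScottContinuous.fst (ScottContinuous.id.prodMk (ScottContinuous.const _))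
      ScottContinuous.snd ((ScottContinuous.const _).prodMk ScottContinuous.id)
      (fun _ => rfl) (fun _ => rfl) (fun _ => rfl) (fun _ => rfl)


theorem rel_comp' {A B C : IntDCPO.{u}} {f : A ⟶ B} {g : B ⟶ C} {x : A.pos} {q : C.neg}
    {z : C.pos} {s : A.neg} :
    Hom.Rel (f ≫ g) x q z s ↔ ∃ y r, Hom.Rel f x r y s ∧ Hom.Rel g y q z r := Hom.rel_comp

theorem rel_id {A : IntDCPO.{u}} {x y : A.pos} {r s : A.neg} :
    Hom.Rel (𝟙 A) x r y s ↔ x ≤ y ∧ r ≤ s := Iff.rfl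

theorem rel_tensor {A B A' B' : IntDCPO.{u}} {f : A ⟶ B} {g : A' ⟶ B'} {x : A.pos} {x' : A'.pos}
    {r : B.neg} {r' : B'.neg} {y : B.pos} {y' : B'.pos} {s : A.neg} {s' : A'.neg} :
    Hom.Rel (f ⊗ₘ g) ((x, x') : A.pos × A'.pos) ((r', r) : B'.neg × B.neg)
      ((y, y') : B.pos × B'.pos) ((s', s) : A'.neg × A.neg) ↔
      Hom.Rel f x r y s ∧ Hom.Rel g x' r' y' s' :=
  ⟨fun ⟨⟨h1, h2⟩, ⟨h3, h4⟩⟩ => ⟨⟨h1, h4⟩, ⟨h2, h3⟩⟩,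
    fun ⟨⟨h1, h4⟩, ⟨h2, h3⟩⟩ => ⟨⟨h1, h2⟩, ⟨h3, h4⟩⟩⟩

section wire

variable {A B C : IntDCPO.{u}} {a : A.pos → B.pos} {a' : B.pos → A.pos}
    {b : A.neg → B.neg} {b' : B.neg → A.neg}
    {ha : ScottContinuous a} {ha' : ScottContinuous a'}
    {hb : ScottContinuous b} {hb' : ScottContinuous b'}
    {h1 : ∀ x, a' (a x) = x} {h2 : ∀ x, a (a' x) = x}
    {h3 : ∀ x, b' (b x) = x} {h4 : ∀ x, b (b' x) = x}

theorem rel_wireIso_comp {f : B ⟶ C} {x : A.pos} {r : C.neg} {z : C.pos} {s : A.neg} :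
    Hom.Rel ((wireIso a a' b b' ha ha' hb hb' h1 h2 h3 h4).hom ≫ f) x r z s ↔
      Hom.Rel f (a x) r z (b s) := by
  rw [rel_comp']
  refine ⟨fun ⟨c, d, ⟨h5, h6⟩, h7⟩ => h7.mono h5 le_rfl le_rfl ?_, fun h =>
    ⟨a x, b s, ⟨le_rfl, (h3 s).le⟩, h⟩⟩
  exact (h4 d).symm.le.trans (hb.monotone h6)

theorem rel_comp_wireIso {f : C ⟶ A} {x : C.pos} {r : B.neg} {z : B.pos} {s : C.neg} :
    Hom.Rel (f ≫ (wireIso a a' b b' ha ha' hb hb' h1 h2 h3 h4).hom) x r z s ↔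
      Hom.Rel f x (b' r) (a' z) s := by
  rw [rel_comp']
  refine ⟨fun ⟨c, d, h7, ⟨h5, h6⟩⟩ => h7.mono le_rfl h6 ?_ le_rfl, fun h =>
    ⟨a' z, b' r, h, ⟨(h2 z).le, le_rfl⟩⟩⟩
  exact (h1 c).symm.le.trans (ha'.monotone h5)

theorem rel_wireIso_inv_comp {f : A ⟶ C} {x : B.pos} {r : C.neg} {z : C.pos} {s : B.neg} :
    Hom.Rel ((wireIso a a' b b' ha ha' hb hb' h1 h2 h3 h4).inv ≫ f) x r z s ↔
      Hom.Rel f (a' x) r z (b' s) :=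
  rel_wireIso_comp (a := a') (a' := a) (b := b') (b' := b) (ha := ha') (ha' := ha) (hb := hb')
    (hb' := hb) (h1 := h2) (h2 := h1) (h3 := h4) (h4 := h3)

end wire

theorem rel_assoc {A B C : IntDCPO.{u}} {x y : A.pos} {x' y' : B.pos} {x'' y'' : C.pos}
    {r s : A.neg} {r' s' : B.neg} {r'' s'' : C.neg} :
    Hom.Rel (α_ A B C).hom (((x, x'), x'') : (A.pos × B.pos) × C.pos)
      (((r'', r'), r) : (C.neg × B.neg) × A.neg) ((y, (y', y'')) : A.pos × (B.pos × C.pos))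
      ((s'', (s', s)) : C.neg × (B.neg × A.neg)) ↔
      (x ≤ y ∧ x' ≤ y' ∧ x'' ≤ y'') ∧ (r ≤ s ∧ r' ≤ s' ∧ r'' ≤ s'') :=
  ⟨fun ⟨⟨h1, h2, h3⟩, ⟨h4, h5, h6⟩⟩ => ⟨⟨h1, h2, h3⟩, ⟨h6, h5, h4⟩⟩,
    fun ⟨⟨h1, h2, h3⟩, ⟨h6, h5, h4⟩⟩ => ⟨⟨h1, h2, h3⟩, ⟨h4, h5, h6⟩⟩⟩

theorem rel_assoc_inv {A B C : IntDCPO.{u}} {x y : A.pos} {x' y' : B.pos} {x'' y'' : C.pos}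
    {r s : A.neg} {r' s' : B.neg} {r'' s'' : C.neg} :
    Hom.Rel (α_ A B C).inv ((x, (x', x'')) : A.pos × (B.pos × C.pos))
      ((r'', (r', r)) : C.neg × (B.neg × A.neg)) (((y, y'), y'') : (A.pos × B.pos) × C.pos)
      (((s'', s'), s) : (C.neg × B.neg) × A.neg) ↔
      (x ≤ y ∧ x' ≤ y' ∧ x'' ≤ y'') ∧ (r ≤ s ∧ r' ≤ s' ∧ r'' ≤ s'') :=
  ⟨fun ⟨⟨⟨h1, h2⟩, h3⟩, ⟨⟨h4, h5⟩, h6⟩⟩ => ⟨⟨h1, h2, h3⟩, ⟨h6, h5, h4⟩⟩,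
    fun ⟨⟨h1, h2, h3⟩, ⟨h6, h5, h4⟩⟩ => ⟨⟨⟨h1, h2⟩, h3⟩, ⟨⟨h4, h5⟩, h6⟩⟩⟩

theorem rel_leftUnitor {A : IntDCPO.{u}} {x y : A.pos} {r s : A.neg} {t t' : PUnit} :
    Hom.Rel (λ_ A).hom ((t, x) : PUnit × A.pos) r y ((s, t') : A.neg × PUnit) ↔ x ≤ y ∧ r ≤ s :=
  ⟨fun ⟨h1, h2⟩ => ⟨h1, h2.1⟩, fun ⟨h1, h2⟩ => ⟨h1, h2, trivial⟩⟩

theorem rel_leftUnitor_inv {A : IntDCPO.{u}} {x y : A.pos} {r s : A.neg} {t t' : PUnit} :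
    Hom.Rel (λ_ A).inv x ((r, t') : A.neg × PUnit) ((t, y) : PUnit × A.pos) s ↔ x ≤ y ∧ r ≤ s :=
  ⟨fun ⟨h1, h2⟩ => ⟨h1.2, h2⟩, fun ⟨h1, h2⟩ => ⟨⟨trivial, h1⟩, h2⟩⟩

theorem rel_rightUnitor {A : IntDCPO.{u}} {x y : A.pos} {r s : A.neg} {t t' : PUnit} :
    Hom.Rel (ρ_ A).hom ((x, t) : A.pos × PUnit) r y ((t', s) : PUnit × A.neg) ↔ x ≤ y ∧ r ≤ s :=
  ⟨fun ⟨h1, h2⟩ => ⟨h1, h2.2⟩, fun ⟨h1, h2⟩ => ⟨h1, trivial, h2⟩⟩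

theorem rel_rightUnitor_inv {A : IntDCPO.{u}} {x y : A.pos} {r s : A.neg} {t t' : PUnit} :
    Hom.Rel (ρ_ A).inv x ((t', r) : PUnit × A.neg) ((y, t) : A.pos × PUnit) s ↔ x ≤ y ∧ r ≤ s :=
  ⟨fun ⟨h1, h2⟩ => ⟨h1.1, h2⟩, fun ⟨h1, h2⟩ => ⟨⟨h1, trivial⟩, h2⟩⟩

/-- The symmetry of `Int(DCPO)`, swapping both parts. -/
noncomputable def swapIso (A B : IntDCPO.{u}) : A ⊗ B ≅ B ⊗ A :=
  wireIso (A := tensorObj A B) (B := tensorObj B A)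
    (fun p : A.pos × B.pos => ((p.2, p.1) : B.pos × A.pos))
    (fun p : B.pos × A.pos => ((p.2, p.1) : A.pos × B.pos))
    (fun p : B.neg × A.neg => ((p.2, p.1) : A.neg × B.neg))
    (fun p : A.neg × B.neg => ((p.2, p.1) : B.neg × A.neg))
    scott_swap scott_swap scott_swap scott_swap
    (fun _ => rfl) (fun _ => rfl) (fun _ => rfl) (fun _ => rfl)

theorem rel_swap {A B : IntDCPO.{u}} {x y : A.pos} {x' y' : B.pos} {r s : A.neg}
    {r' s' : B.neg} :
    Hom.Rel (swapIso A B).hom ((x, x') : A.pos × B.pos) ((r, r') : A.neg × B.neg)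
      ((y', y) : B.pos × A.pos) ((s', s) : B.neg × A.neg) ↔
      (x ≤ y ∧ r ≤ s) ∧ (x' ≤ y' ∧ r' ≤ s') :=
  ⟨fun ⟨⟨h1, h2⟩, ⟨h3, h4⟩⟩ => ⟨⟨h2, h4⟩, ⟨h1, h3⟩⟩,
    fun ⟨⟨h2, h4⟩, ⟨h1, h3⟩⟩ => ⟨⟨h1, h2⟩, ⟨h3, h4⟩⟩⟩

noncomputable instance : MonoidalCategory IntDCPO.{u} :=
  MonoidalCategory.ofTensorHom
    (id_tensorHom_id := fun A B => Hom.ext_rel <| by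
      rintro ⟨x, x'⟩ ⟨r', r⟩ ⟨y, y'⟩ ⟨s', s⟩
      exact rel_tensor.trans ⟨fun ⟨⟨h1, h4⟩, ⟨h2, h3⟩⟩ => ⟨⟨h1, h2⟩, ⟨h3, h4⟩⟩,
        fun ⟨⟨h1, h2⟩, ⟨h3, h4⟩⟩ => ⟨⟨h1, h4⟩, ⟨h2, h3⟩⟩⟩)
    (id_tensorHom := fun _ _ _ _ => rfl)
    (tensorHom_id := fun _ _ => rfl)
    (tensorHom_comp_tensorHom := fun f₁ f₂ g₁ g₂ =>
      Hom.ext_rel <| by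
        rintro ⟨x, x'⟩ ⟨r', r⟩ ⟨y, y'⟩ ⟨s', s⟩
        refine rel_comp'.trans (Iff.trans ?_ rel_tensor.symm)
        rw [rel_comp', rel_comp']
        constructor
        · rintro ⟨⟨c, c'⟩, ⟨d', d⟩, h1, h2⟩
          have h1 := rel_tensor.1 h1
          have h2 := rel_tensor.1 h2
          exact ⟨⟨c, d, h1.1, h2.1⟩, ⟨c', d', h1.2, h2.2⟩⟩
        · rintro ⟨⟨c, d, h1, h2⟩, ⟨c', d', h3, h4⟩⟩
          exact ⟨(c, c'), (d', d), rel_tensor.2 ⟨h1, h3⟩, rel_tensor.2 ⟨h2, h4⟩⟩)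
    (associator_naturality := fun f₁ f₂ f₃ =>
      Hom.ext_rel <| by
        rintro ⟨⟨x, x'⟩, x''⟩ ⟨⟨r'', r'⟩, r⟩ ⟨y, ⟨y', y''⟩⟩ ⟨s'', ⟨s', s⟩⟩
        refine rel_comp_wireIso.trans (Iff.trans ?_ rel_wireIso_comp.symm)
        refine rel_tensor.trans (Iff.trans ?_ rel_tensor.symm)
        exact ((and_congr_left' rel_tensor).trans and_assoc).trans
          (and_congr_right' rel_tensor.symm))
    (leftUnitor_naturality := fun f =>
      Hom.ext_rel <| by
        rintro ⟨u, x⟩ r y ⟨s, v⟩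
        refine rel_comp_wireIso.trans (Iff.trans ?_ rel_wireIso_comp.symm)
        exact rel_tensor.trans (and_iff_right ⟨le_rfl, le_rfl⟩))
    (rightUnitor_naturality := fun f =>
      Hom.ext_rel <| by
        rintro ⟨x, u⟩ r y ⟨v, s⟩
        refine rel_comp_wireIso.trans (Iff.trans ?_ rel_wireIso_comp.symm)
        exact rel_tensor.trans (and_iff_left ⟨le_rfl, le_rfl⟩))
    (pentagon := fun A B C D =>
      Hom.ext_rel <| by
        rintro ⟨⟨⟨x₁, x₂⟩, x₃⟩, x₄⟩ ⟨⟨⟨r₄, r₃⟩, r₂⟩, r₁⟩ ⟨y₁, ⟨y₂, ⟨y₃, y₄⟩⟩⟩ ⟨s₄, ⟨s₃, ⟨s₂, s₁⟩⟩⟩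
        constructor
        · intro h
          obtain ⟨⟨⟨c₁, ⟨c₂, c₃⟩⟩, c₄⟩, ⟨d₄, ⟨⟨d₃, d₂⟩, d₁⟩⟩, h1, h⟩ := rel_comp'.1 h
          obtain ⟨⟨e₁, ⟨⟨e₂, e₃⟩, e₄⟩⟩, ⟨⟨f₄, ⟨f₃, f₂⟩⟩, f₁⟩, h2, h3⟩ := rel_comp'.1 h
          obtain ⟨h1, ⟨a4, b4⟩⟩ := (rel_tensor (f := (α_ A B C).hom) (g := 𝟙 D)).1 h1
          obtain ⟨⟨a1, a2, a3⟩, ⟨b1, b2, b3⟩⟩ := rel_assoc.1 h1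
          obtain ⟨⟨c1, ⟨c2, c3⟩, c4⟩, ⟨d1, ⟨d3, d2⟩, d4⟩⟩ := (rel_assoc (B := B ⊗ C)).1 h2
          obtain ⟨⟨e1, f1⟩, h3⟩ := (rel_tensor (f := 𝟙 A) (g := (α_ B C D).hom)).1 h3
          obtain ⟨⟨e2, e3, e4⟩, ⟨f2, f3, f4⟩⟩ := rel_assoc.1 h3
          refine rel_comp'.2 ⟨(((y₁, y₂), (y₃, y₄)) : (A.pos × B.pos) × (C.pos × D.pos)),
            (((r₄, r₃), (r₂, r₁)) : (D.neg × C.neg) × (B.neg × A.neg)),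
            (rel_assoc (A := A ⊗ B)).2 ⟨⟨⟨?_, ?_⟩, ?_, ?_⟩, ⟨⟨?_, ?_⟩, ?_, ?_⟩⟩,
            (rel_assoc (C := C ⊗ D)).2
              ⟨⟨le_rfl, le_rfl, le_rfl⟩, ⟨le_rfl, le_rfl, le_rfl⟩⟩⟩
          · exact a1.trans (c1.trans e1)
          · exact a2.trans (c2.trans e2)
          · exact a3.trans (c3.trans e3)
          · exact a4.trans (c4.trans e4)
          · exact f2.trans (d2.trans b2)
          · exact f1.trans (d1.trans b1)
          · exact f3.trans (d3.trans b3)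
          · exact f4.trans (d4.trans b4)
        · intro h
          obtain ⟨⟨⟨c₁, c₂⟩, ⟨c₃, c₄⟩⟩, ⟨⟨d₄, d₃⟩, ⟨d₂, d₁⟩⟩, h1, h⟩ := rel_comp'.1 h
          obtain ⟨⟨⟨a1, a2⟩, a3, a4⟩, ⟨⟨b2, b1⟩, b3, b4⟩⟩ := (rel_assoc (A := A ⊗ B)).1 h1
          obtain ⟨⟨c1, c2, ⟨c3, c4⟩⟩, ⟨d1, d2, ⟨d4, d3⟩⟩⟩ := (rel_assoc (C := C ⊗ D)).1 h
          refine rel_comp'.2 ⟨(((y₁, (y₂, y₃)), y₄) : (A.pos × (B.pos × C.pos)) × D.pos),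
            ((r₄, ((r₃, r₂), r₁)) : D.neg × ((C.neg × B.neg) × A.neg)),
            (rel_tensor (f := (α_ A B C).hom) (g := 𝟙 D)).2
              ⟨rel_assoc.2 ⟨⟨?_, ?_, ?_⟩, ⟨?_, ?_, ?_⟩⟩, ⟨?_, ?_⟩⟩,
            rel_comp'.2 ⟨((y₁, ((y₂, y₃), y₄)) : A.pos × ((B.pos × C.pos) × D.pos)),
              (((r₄, (r₃, r₂)), r₁) : (D.neg × (C.neg × B.neg)) × A.neg),
              (rel_assoc (B := B ⊗ C)).2
                ⟨⟨le_rfl, ⟨le_rfl, le_rfl⟩, le_rfl⟩, ⟨le_rfl, ⟨le_rfl, le_rfl⟩, le_rfl⟩⟩,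
              (rel_tensor (f := 𝟙 A) (g := (α_ B C D).hom)).2 ⟨⟨le_rfl, le_rfl⟩,
                rel_assoc.2 ⟨⟨le_rfl, le_rfl, le_rfl⟩, ⟨le_rfl, le_rfl, le_rfl⟩⟩⟩⟩⟩
          · exact a1.trans c1
          · exact a2.trans c2
          · exact a3.trans c3
          · exact d1.trans b1
          · exact d2.trans b2
          · exact d3.trans b3
          · exact a4.trans c4
          · exact d4.trans b4)
    (triangle := fun A B =>
      Hom.ext_rel <| by
        rintro ⟨⟨x, u⟩, x'⟩ ⟨r', r⟩ ⟨y, y'⟩ ⟨s', ⟨v, s⟩⟩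
        constructor
        · intro h
          obtain ⟨⟨c₁, ⟨c₂, c₃⟩⟩, ⟨⟨d₃, d₂⟩, d₁⟩, h1, h⟩ := rel_comp'.1 h
          obtain ⟨⟨a1, a2, a3⟩, ⟨b1, b2, b3⟩⟩ := rel_assoc.1 h1
          obtain ⟨⟨e1, f1⟩, h⟩ := (rel_tensor (f := 𝟙 A) (g := (λ_ B).hom)).1 h
          obtain ⟨e3, f3⟩ := rel_leftUnitor.1 h
          exact (rel_tensor (f := (ρ_ A).hom) (g := 𝟙 B)).2
            ⟨rel_rightUnitor.2 ⟨a1.trans e1, f1.trans b1⟩, ⟨a3.trans e3, f3.trans b3⟩⟩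
        · intro h
          obtain ⟨h, ⟨e3, f3⟩⟩ := (rel_tensor (f := (ρ_ A).hom) (g := 𝟙 B)).1 h
          obtain ⟨e1, f1⟩ := rel_rightUnitor.1 h
          exact rel_comp'.2 ⟨((y, (u, y')) : A.pos × (PUnit × B.pos)),
            (((r', v), r) : (B.neg × PUnit) × A.neg),
            (rel_assoc (B := 𝟙_ IntDCPO.{u})).2 ⟨⟨e1, le_rfl, e3⟩, ⟨f1, le_rfl, f3⟩⟩,
            (rel_tensor (f := 𝟙 A) (g := (λ_ B).hom)).2
              ⟨⟨le_rfl, le_rfl⟩, rel_leftUnitor.2 ⟨le_rfl, le_rfl⟩⟩⟩)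

noncomputable instance : SymmetricCategory IntDCPO.{u} where
  braiding := swapIso
  braiding_naturality_right A _ _ f :=
    Hom.ext_rel <| by
      rintro ⟨x, x'⟩ ⟨r', r⟩ ⟨y, y'⟩ ⟨s', s⟩
      refine rel_comp_wireIso.trans (Iff.trans ?_ rel_wireIso_comp.symm)
      exact (rel_tensor (f := 𝟙 A) (g := f)).trans (and_comm.trans rel_tensor.symm)
  braiding_naturality_left f A :=
    Hom.ext_rel <| by
      rintro ⟨x, x'⟩ ⟨r', r⟩ ⟨y, y'⟩ ⟨s', s⟩
      refine rel_comp_wireIso.trans (Iff.trans ?_ rel_wireIso_comp.symm)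
      exact (rel_tensor (f := f) (g := 𝟙 A)).trans (and_comm.trans rel_tensor.symm)
  hexagon_forward A B C :=
    Hom.ext_rel <| by
      rintro ⟨⟨x₁, x₂⟩, x₃⟩ ⟨⟨r₁, r₃⟩, r₂⟩ ⟨y₂, ⟨y₃, y₁⟩⟩ ⟨s₃, ⟨s₂, s₁⟩⟩
      constructor
      · intro h
        obtain ⟨⟨c₁, ⟨c₂, c₃⟩⟩, ⟨⟨d₃, d₂⟩, d₁⟩, h1, h⟩ := rel_comp'.1 h
        obtain ⟨⟨⟨e₂, e₃⟩, e₁⟩, ⟨f₁, ⟨f₃, f₂⟩⟩, h2, h3⟩ := rel_comp'.1 h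
        obtain ⟨⟨p1, p2, p3⟩, ⟨q1, q2, q3⟩⟩ := rel_assoc.1 h1
        obtain ⟨⟨u1, v1⟩, ⟨⟨u2, u3⟩, ⟨v3, v2⟩⟩⟩ := (rel_swap (B := B ⊗ C)).1 h2
        obtain ⟨⟨k2, k3, k1⟩, ⟨l2, l3, l1⟩⟩ := rel_assoc.1 h3
        refine rel_comp'.2 ⟨(((y₂, y₁), x₃) : (B.pos × A.pos) × C.pos),
          ((s₃, (r₁, r₂)) : C.neg × (A.neg × B.neg)),
          (rel_tensor (f := (swapIso A B).hom) (g := 𝟙 C)).2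
            ⟨rel_swap.2 ⟨⟨?_, ?_⟩, ⟨?_, ?_⟩⟩, ⟨le_rfl, le_rfl⟩⟩,
          rel_comp'.2 ⟨((y₂, (y₁, x₃)) : B.pos × (A.pos × C.pos)),
            (((s₃, r₁), r₂) : (C.neg × A.neg) × B.neg),
            rel_assoc.2 ⟨⟨le_rfl, le_rfl, le_rfl⟩, ⟨le_rfl, le_rfl, le_rfl⟩⟩,
            (rel_tensor (f := 𝟙 B) (g := (swapIso A C).hom)).2
              ⟨⟨le_rfl, le_rfl⟩, rel_swap.2 ⟨⟨le_rfl, le_rfl⟩, ⟨?_, ?_⟩⟩⟩⟩⟩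
        · exact p1.trans (u1.trans k1)
        · exact l1.trans (v1.trans q1)
        · exact p2.trans (u2.trans k2)
        · exact l2.trans (v2.trans q2)
        · exact p3.trans (u3.trans k3)
        · exact l3.trans (v3.trans q3)
      · intro h
        obtain ⟨⟨⟨c₂, c₁⟩, c₃⟩, ⟨d₃, ⟨d₁, d₂⟩⟩, h1, h⟩ := rel_comp'.1 h
        obtain ⟨⟨e₂, ⟨e₁, e₃⟩⟩, ⟨⟨f₃, f₁⟩, f₂⟩, h2, h3⟩ := rel_comp'.1 h
        obtain ⟨h1, ⟨p3, q3⟩⟩ := (rel_tensor (f := (swapIso A B).hom) (g := 𝟙 C)).1 h1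
        obtain ⟨⟨p1, q1⟩, ⟨p2, q2⟩⟩ := rel_swap.1 h1
        obtain ⟨⟨u2, u1, u3⟩, ⟨v2, v1, v3⟩⟩ := rel_assoc.1 h2
        obtain ⟨⟨k2, l2⟩, h3⟩ := (rel_tensor (f := 𝟙 B) (g := (swapIso A C).hom)).1 h3
        obtain ⟨⟨k1, l1⟩, ⟨k3, l3⟩⟩ := rel_swap.1 h3
        refine rel_comp'.2 ⟨((y₁, (y₂, y₃)) : A.pos × (B.pos × C.pos)),
          (((r₃, r₂), r₁) : (C.neg × B.neg) × A.neg),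
          rel_assoc.2 ⟨⟨?_, ?_, ?_⟩, ⟨?_, ?_, ?_⟩⟩,
          rel_comp'.2 ⟨(((y₂, y₃), y₁) : (B.pos × C.pos) × A.pos),
            ((r₁, (r₃, r₂)) : A.neg × (C.neg × B.neg)),
            (rel_swap (B := B ⊗ C)).2 ⟨⟨le_rfl, le_rfl⟩, ⟨⟨le_rfl, le_rfl⟩, ⟨le_rfl, le_rfl⟩⟩⟩,
            rel_assoc.2 ⟨⟨le_rfl, le_rfl, le_rfl⟩, ⟨le_rfl, le_rfl, le_rfl⟩⟩⟩⟩
        · exact p1.trans (u1.trans k1)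
        · exact p2.trans (u2.trans k2)
        · exact p3.trans (u3.trans k3)
        · exact l1.trans (v1.trans q1)
        · exact l2.trans (v2.trans q2)
        · exact l3.trans (v3.trans q3)
  hexagon_reverse A B C :=
    Hom.ext_rel <| by
      rintro ⟨x₁, ⟨x₂, x₃⟩⟩ ⟨r₂, ⟨r₁, r₃⟩⟩ ⟨⟨y₃, y₁⟩, y₂⟩ ⟨⟨s₃, s₂⟩, s₁⟩
      constructor
      · intro h
        obtain ⟨⟨⟨c₁, c₂⟩, c₃⟩, ⟨d₃, ⟨d₂, d₁⟩⟩, h1, h⟩ := rel_comp'.1 h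
        obtain ⟨⟨e₃, ⟨e₁, e₂⟩⟩, ⟨⟨f₂, f₁⟩, f₃⟩, h2, h3⟩ := rel_comp'.1 h
        obtain ⟨⟨p1, p2, p3⟩, ⟨q1, q2, q3⟩⟩ := rel_assoc_inv.1 h1
        obtain ⟨⟨⟨u1, u2⟩, ⟨v2, v1⟩⟩, ⟨u3, v3⟩⟩ := (rel_swap (A := A ⊗ B)).1 h2
        obtain ⟨⟨k3, k1, k2⟩, ⟨l3, l1, l2⟩⟩ := rel_assoc_inv.1 h3
        refine rel_comp'.2 ⟨((x₁, (y₃, y₂)) : A.pos × (C.pos × B.pos)),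
          (((r₂, r₃), s₁) : (B.neg × C.neg) × A.neg),
          (rel_tensor (f := 𝟙 A) (g := (swapIso B C).hom)).2
            ⟨⟨le_rfl, le_rfl⟩, rel_swap.2 ⟨⟨?_, ?_⟩, ⟨?_, ?_⟩⟩⟩,
          rel_comp'.2 ⟨(((x₁, y₃), y₂) : (A.pos × C.pos) × B.pos),
            ((r₂, (r₃, s₁)) : B.neg × (C.neg × A.neg)),
            rel_assoc_inv.2 ⟨⟨le_rfl, le_rfl, le_rfl⟩, ⟨le_rfl, le_rfl, le_rfl⟩⟩,
            (rel_tensor (f := (swapIso A C).hom) (g := 𝟙 B)).2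
              ⟨rel_swap.2 ⟨⟨?_, ?_⟩, ⟨le_rfl, le_rfl⟩⟩, ⟨le_rfl, le_rfl⟩⟩⟩⟩
        · exact p2.trans (u2.trans k2)
        · exact l2.trans (v2.trans q2)
        · exact p3.trans (u3.trans k3)
        · exact l3.trans (v3.trans q3)
        · exact p1.trans (u1.trans k1)
        · exact l1.trans (v1.trans q1)
      · intro h
        obtain ⟨⟨c₁, ⟨c₃, c₂⟩⟩, ⟨⟨d₂, d₃⟩, d₁⟩, h1, h⟩ := rel_comp'.1 h
        obtain ⟨⟨⟨e₁, e₃⟩, e₂⟩, ⟨f₂, ⟨f₃, f₁⟩⟩, h2, h3⟩ := rel_comp'.1 h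
        obtain ⟨⟨p1, q1⟩, h1⟩ := (rel_tensor (f := 𝟙 A) (g := (swapIso B C).hom)).1 h1
        obtain ⟨⟨p2, q2⟩, ⟨p3, q3⟩⟩ := rel_swap.1 h1
        obtain ⟨⟨u1, u3, u2⟩, ⟨v1, v3, v2⟩⟩ := rel_assoc_inv.1 h2
        obtain ⟨h3, ⟨k2, l2⟩⟩ := (rel_tensor (f := (swapIso A C).hom) (g := 𝟙 B)).1 h3
        obtain ⟨⟨k1, l1⟩, ⟨k3, l3⟩⟩ := rel_swap.1 h3
        refine rel_comp'.2 ⟨(((y₁, y₂), y₃) : (A.pos × B.pos) × C.pos),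
          ((r₃, (r₂, r₁)) : C.neg × (B.neg × A.neg)),
          rel_assoc_inv.2 ⟨⟨?_, ?_, ?_⟩, ⟨?_, ?_, ?_⟩⟩,
          rel_comp'.2 ⟨((y₃, (y₁, y₂)) : C.pos × (A.pos × B.pos)),
            (((r₂, r₁), r₃) : (B.neg × A.neg) × C.neg),
            (rel_swap (A := A ⊗ B)).2 ⟨⟨⟨le_rfl, le_rfl⟩, ⟨le_rfl, le_rfl⟩⟩, ⟨le_rfl, le_rfl⟩⟩,
            rel_assoc_inv.2 ⟨⟨le_rfl, le_rfl, le_rfl⟩, ⟨le_rfl, le_rfl, le_rfl⟩⟩⟩⟩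
        · exact p1.trans (u1.trans k1)
        · exact p2.trans (u2.trans k2)
        · exact p3.trans (u3.trans k3)
        · exact l1.trans (v1.trans q1)
        · exact l2.trans (v2.trans q2)
        · exact l3.trans (v3.trans q3)
  symmetry A B := (swapIso A B).hom_inv_id


/-- The dual `(X, S)* = (S, X)`. -/
def dual (A : IntDCPO.{u}) : IntDCPO.{u} := ⟨A.neg, A.pos⟩

/-- The unit `I ⟶ A ⊗ A*`, carried by the identity of `X × S`. -/
noncomputable def unit (A : IntDCPO.{u}) : 𝟙_ IntDCPO.{u} ⟶ A ⊗ A.dual :=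
  Hom.ofFun (A := 𝟙_ IntDCPO.{u}) (B := tensorObj A A.dual)
    (fun p : PUnit × (A.pos × A.neg) => ((p.2, PUnit.unit) : (A.pos × A.neg) × PUnit))
    (ScottContinuous.snd.prodMk (ScottContinuous.const _))

/-- The counit `A* ⊗ A ⟶ I`, carried by the identity of `S × X`. -/
noncomputable def counit (A : IntDCPO.{u}) : A.dual ⊗ A ⟶ 𝟙_ IntDCPO.{u} :=
  Hom.ofFun (A := tensorObj A.dual A) (B := 𝟙_ IntDCPO.{u})
    (fun p : (A.neg × A.pos) × PUnit => ((PUnit.unit, p.1) : PUnit × (A.neg × A.pos)))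
    ((ScottContinuous.const _).prodMk ScottContinuous.fst)

theorem rel_unit {A : IntDCPO.{u}} {x y : A.pos} {r s : A.neg} {t t' : PUnit} :
    Hom.Rel (unit A) t ((x, r) : A.pos × A.neg) ((y, s) : A.pos × A.neg) t' ↔ x ≤ y ∧ r ≤ s :=
  ⟨fun ⟨h, _⟩ => h, fun h => ⟨h, trivial⟩⟩

theorem rel_counit {A : IntDCPO.{u}} {x y : A.pos} {r s : A.neg} {t t' : PUnit} :
    Hom.Rel (counit A) ((r, x) : A.neg × A.pos) t t' ((s, y) : A.neg × A.pos) ↔ x ≤ y ∧ r ≤ s :=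
  ⟨fun ⟨_, h1, h2⟩ => ⟨h2, h1⟩, fun ⟨h2, h1⟩ => ⟨trivial, h1, h2⟩⟩

/-- The duality of the compact closed category `Int(DCPO)`. -/
noncomputable instance pairing (A : IntDCPO.{u}) : ExactPairing A A.dual where
  coevaluation' := unit A
  evaluation' := counit A
  coevaluation_evaluation' := Hom.ext_rel <| by
    rintro ⟨x, t⟩ ⟨r, t'⟩ ⟨t'', y⟩ ⟨t''', s⟩
    constructor
    · intro h
      obtain ⟨⟨c₁, ⟨c₂, c₃⟩⟩, ⟨⟨d₃, d₂⟩, d₁⟩, h1, h⟩ := rel_comp'.1 h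
      obtain ⟨⟨⟨e₁, e₂⟩, e₃⟩, ⟨f₃, ⟨f₂, f₁⟩⟩, h2, h3⟩ := rel_comp'.1 h
      obtain ⟨⟨p1, q1⟩, h1⟩ := (rel_tensor (f := 𝟙 A.dual) (g := unit A)).1 h1
      obtain ⟨p2, q2⟩ := (rel_unit (t := PUnit.unit) (t' := PUnit.unit)).1 h1
      obtain ⟨⟨u1, u2, u3⟩, ⟨v1, v2, v3⟩⟩ := rel_assoc_inv.1 h2
      obtain ⟨h3, ⟨k3, l3⟩⟩ := (rel_tensor (f := counit A) (g := 𝟙 A.dual)).1 h3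
      obtain ⟨k2, l2⟩ := (rel_counit (t := PUnit.unit) (t' := PUnit.unit)).1 h3
      refine rel_comp'.2 ⟨y, r, rel_rightUnitor.2 ⟨?_, ?_⟩, rel_leftUnitor_inv.2 ⟨le_rfl, le_rfl⟩⟩
      · exact p1.trans (u1.trans (l2.trans (v2.trans (q2.trans (u3.trans k3)))))
      · exact l3.trans (v3.trans (p2.trans (u2.trans (k2.trans (v1.trans q1)))))
    · intro h
      obtain ⟨c, d, h1, h2⟩ := rel_comp'.1 h
      obtain ⟨p, q⟩ := rel_rightUnitor.1 h1
      obtain ⟨u, v⟩ := rel_leftUnitor_inv.1 h2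
      refine rel_comp'.2 ⟨((x, (s, x)) : A.neg × (A.pos × A.neg)),
        (((s, x), s) : (A.pos × A.neg) × A.pos),
        (rel_tensor (f := 𝟙 A.dual) (g := unit A)).2 ⟨⟨le_rfl, le_rfl⟩,
          (rel_unit (t := PUnit.unit) (t' := PUnit.unit)).2 ⟨le_rfl, le_rfl⟩⟩,
        rel_comp'.2 ⟨(((x, s), y) : (A.neg × A.pos) × A.neg),
          ((r, (x, s)) : A.pos × (A.neg × A.pos)), rel_assoc_inv.2
            ⟨⟨le_rfl, le_rfl, p.trans u⟩, ⟨le_rfl, le_rfl, v.trans q⟩⟩,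
          (rel_tensor (f := counit A) (g := 𝟙 A.dual)).2 ⟨
            (rel_counit (t := PUnit.unit) (t' := PUnit.unit)).2 ⟨le_rfl, le_rfl⟩,
            ⟨le_rfl, le_rfl⟩⟩⟩⟩
  evaluation_coevaluation' := Hom.ext_rel <| by
    rintro ⟨t, x⟩ ⟨t', r⟩ ⟨y, t''⟩ ⟨s, t'''⟩
    constructor
    · intro h
      obtain ⟨⟨⟨c₁, c₂⟩, c₃⟩, ⟨d₃, ⟨d₂, d₁⟩⟩, h1, h⟩ := rel_comp'.1 h
      obtain ⟨⟨e₁, ⟨e₂, e₃⟩⟩, ⟨⟨f₃, f₂⟩, f₁⟩, h2, h3⟩ := rel_comp'.1 h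
      obtain ⟨h1, ⟨p3, q3⟩⟩ := (rel_tensor (f := unit A) (g := 𝟙 A)).1 h1
      obtain ⟨p2, q2⟩ := (rel_unit (t := PUnit.unit) (t' := PUnit.unit)).1 h1
      obtain ⟨⟨u1, u2, u3⟩, ⟨v1, v2, v3⟩⟩ := rel_assoc.1 h2
      obtain ⟨⟨k1, l1⟩, h3⟩ := (rel_tensor (f := 𝟙 A) (g := counit A)).1 h3
      obtain ⟨k2, l2⟩ := (rel_counit (t := PUnit.unit) (t' := PUnit.unit)).1 h3
      refine rel_comp'.2 ⟨y, r, rel_leftUnitor.2 ⟨?_, ?_⟩, rel_rightUnitor_inv.2 ⟨le_rfl, le_rfl⟩⟩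
      · exact p3.trans (u3.trans (k2.trans (v2.trans (p2.trans (u1.trans k1)))))
      · exact l1.trans (v1.trans (q2.trans (u2.trans (l2.trans (v3.trans q3)))))
    · intro h
      obtain ⟨c, d, h1, h2⟩ := rel_comp'.1 h
      obtain ⟨p, q⟩ := rel_leftUnitor.1 h1
      obtain ⟨u, v⟩ := rel_rightUnitor_inv.1 h2
      refine rel_comp'.2 ⟨(((x, s), x) : (A.pos × A.neg) × A.pos),
        ((s, (x, s)) : A.neg × (A.pos × A.neg)),
        (rel_tensor (f := unit A) (g := 𝟙 A)).2 ⟨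
          (rel_unit (t := PUnit.unit) (t' := PUnit.unit)).2 ⟨le_rfl, le_rfl⟩,
          ⟨le_rfl, le_rfl⟩⟩,
        rel_comp'.2 ⟨((y, (s, x)) : A.pos × (A.neg × A.pos)),
          (((s, x), r) : (A.neg × A.pos) × A.neg), rel_assoc.2
            ⟨⟨p.trans u, le_rfl, le_rfl⟩, ⟨v.trans q, le_rfl, le_rfl⟩⟩,
          (rel_tensor (f := 𝟙 A) (g := counit A)).2 ⟨⟨le_rfl, le_rfl⟩,
            (rel_counit (t := PUnit.unit) (t' := PUnit.unit)).2 ⟨le_rfl, le_rfl⟩⟩⟩⟩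

/-- The trace of `Int(DCPO)`, defined from its compact closed structure. -/
noncomputable def tr {A B : IntDCPO.{u}} (U : IntDCPO.{u}) (f : A ⊗ U ⟶ B ⊗ U) : A ⟶ B :=
  (ρ_ A).inv ≫ A ◁ η_ U U.dual ≫ (α_ A U U.dual).inv ≫ f ▷ U.dual ≫ (α_ B U U.dual).hom ≫
    B ◁ ((β_ U U.dual).hom ≫ ε_ U U.dual) ≫ (ρ_ B).hom

theorem rel_tr {A B U : IntDCPO.{u}} {f : A ⊗ U ⟶ B ⊗ U} {x : A.pos} {r : B.neg} {y : B.pos}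
    {s : A.neg} :
    Hom.Rel (tr U f) x r y s ↔ ∃ (u : U.pos) (v : U.neg),
      Hom.Rel f ((x, u) : A.pos × U.pos) ((v, r) : U.neg × B.neg) ((y, u) : B.pos × U.pos)
        ((v, s) : U.neg × A.neg) := by
  constructor
  · intro h
    obtain ⟨⟨c₁, t⟩, ⟨t', d₁⟩, h1, h⟩ := rel_comp'.1 h
    obtain ⟨p1, q1⟩ := rel_rightUnitor_inv.1 h1
    obtain ⟨⟨c₂, ⟨u₁, v₁⟩⟩, ⟨⟨u₂, v₂⟩, d₂⟩, h2, h⟩ := rel_comp'.1 h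
    obtain ⟨⟨p2, q2⟩, h2⟩ := (rel_tensor (f := 𝟙 A) (g := unit U)).1 h2
    obtain ⟨p3, q3⟩ := rel_unit.1 h2
    obtain ⟨⟨⟨c₃, u₃⟩, v₃⟩, ⟨u₄, ⟨v₄, d₃⟩⟩, h3, h⟩ := rel_comp'.1 h
    obtain ⟨⟨p4, p5, p6⟩, ⟨q4, q5, q6⟩⟩ := rel_assoc_inv.1 h3
    obtain ⟨⟨⟨c₄, u₅⟩, v₅⟩, ⟨u₆, ⟨v₆, d₄⟩⟩, h4, h⟩ := rel_comp'.1 h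
    obtain ⟨hf, ⟨p7, q7⟩⟩ := (rel_tensor (f := f) (g := 𝟙 U.dual)).1 h4
    obtain ⟨⟨c₅, ⟨u₇, v₇⟩⟩, ⟨⟨u₈, v₈⟩, d₅⟩, h5, h⟩ := rel_comp'.1 h
    obtain ⟨⟨p8, p9, p10⟩, ⟨q8, q9, q10⟩⟩ := rel_assoc.1 h5
    obtain ⟨⟨c₆, t⟩, ⟨t', d₆⟩, h6, h⟩ := rel_comp'.1 h
    obtain ⟨p11, q11⟩ := rel_rightUnitor.1 h
    obtain ⟨⟨p12, q12⟩, h6⟩ :=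
      (rel_tensor (f := 𝟙 B) (g := (β_ U U.dual).hom ≫ ε_ U U.dual)).1 h6
    obtain ⟨⟨v₉, u₉⟩, ⟨v₁₀, u₁₀⟩, h7, h8⟩ := rel_comp'.1 h6
    obtain ⟨⟨p13, q13⟩, ⟨p14, q14⟩⟩ := (rel_swap (A := U) (B := U.dual)).1 h7
    obtain ⟨p15, q15⟩ := rel_counit.1 h8
    refine ⟨u₅, v₆, hf.mono ⟨p1.trans (p2.trans p4), ?_⟩ ⟨le_rfl, q11.trans (q12.trans q8)⟩
      ⟨p8.trans (p12.trans p11), le_rfl⟩ ⟨?_, q4.trans (q2.trans q1)⟩⟩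
    · exact (p9.trans (p13.trans (p15.trans (q14.trans (q10.trans (q7.trans (q6.trans
        (p3.trans p5))))))))
    · exact (q5.trans (q3.trans (p6.trans (p7.trans (p10.trans (p14.trans (q15.trans
        (q13.trans q9))))))))
  · rintro ⟨u, v, hf⟩
    refine rel_comp'.2 ⟨((x, PUnit.unit) : A.pos × PUnit), ((PUnit.unit, s) : PUnit × A.neg),
      rel_rightUnitor_inv.2 ⟨le_rfl, le_rfl⟩, ?_⟩
    refine rel_comp'.2 ⟨((x, (u, v)) : A.pos × (U.pos × U.neg)),
      (((u, v), s) : (U.pos × U.neg) × A.neg),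
      (rel_tensor (f := 𝟙 A) (g := unit U)).2 ⟨⟨le_rfl, le_rfl⟩, rel_unit.2 ⟨le_rfl, le_rfl⟩⟩, ?_⟩
    refine rel_comp'.2 ⟨(((x, u), v) : (A.pos × U.pos) × U.neg),
      ((u, (v, s)) : U.pos × (U.neg × A.neg)),
      rel_assoc_inv.2 ⟨⟨le_rfl, le_rfl, le_rfl⟩, ⟨le_rfl, le_rfl, le_rfl⟩⟩, ?_⟩
    refine rel_comp'.2 ⟨(((y, u), v) : (B.pos × U.pos) × U.neg),
      ((u, (v, r)) : U.pos × (U.neg × B.neg)),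
      (rel_tensor (f := f) (g := 𝟙 U.dual)).2 ⟨hf, ⟨le_rfl, le_rfl⟩⟩, ?_⟩
    refine rel_comp'.2 ⟨((y, (u, v)) : B.pos × (U.pos × U.neg)),
      (((u, v), r) : (U.pos × U.neg) × B.neg),
      rel_assoc.2 ⟨⟨le_rfl, le_rfl, le_rfl⟩, ⟨le_rfl, le_rfl, le_rfl⟩⟩, ?_⟩
    refine rel_comp'.2 ⟨((y, PUnit.unit) : B.pos × PUnit), ((PUnit.unit, r) : PUnit × B.neg),
      (rel_tensor (f := 𝟙 B) (g := (β_ U U.dual).hom ≫ ε_ U U.dual)).2 ⟨⟨le_rfl, le_rfl⟩, ?_⟩,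
      rel_rightUnitor.2 ⟨le_rfl, le_rfl⟩⟩
    exact rel_comp'.2 ⟨((v, u) : U.neg × U.pos), ((v, u) : U.neg × U.pos),
      (rel_swap (A := U) (B := U.dual)).2 ⟨⟨le_rfl, le_rfl⟩, ⟨le_rfl, le_rfl⟩⟩,
      rel_counit.2 ⟨le_rfl, le_rfl⟩⟩

/-! ### Contexts

A context for `A ⟶ B` is a morphism `κ : B ⟶ A`. It is contravariant in `B` by precomposition and
covariant in `A` by postcomposition. -/

/-- `l / κ`: close a context `κ` for `X₁ ⊗ X₂ ⟶ Y₁ ⊗ Y₂` with `l : X₂ ⟶ Y₂` to obtain a context for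
`X₁ ⟶ Y₁`, by running `l` after `κ` on `X₂` and tracing out `Y₂`. -/
noncomputable def slash {X₁ X₂ Y₁ Y₂ : IntDCPO.{u}} (l : X₂ ⟶ Y₂) (κ : Y₁ ⊗ Y₂ ⟶ X₁ ⊗ X₂) :
    Y₁ ⟶ X₁ :=
  tr Y₂ (κ ≫ X₁ ◁ l)

/-- `l \ κ`: close a context `κ` for `X₁ ⊗ X₂ ⟶ Y₁ ⊗ Y₂` with `l : X₁ ⟶ Y₁` to obtain a context for
`X₂ ⟶ Y₂`; it is derived from `/` by the symmetry. -/
noncomputable def backslash {X₁ X₂ Y₁ Y₂ : IntDCPO.{u}} (l : X₁ ⟶ Y₁)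
    (κ : Y₁ ⊗ Y₂ ⟶ X₁ ⊗ X₂) : Y₂ ⟶ X₂ :=
  slash l ((β_ Y₂ Y₁).hom ≫ κ ≫ (β_ X₁ X₂).hom)

theorem rel_slash {X₁ X₂ Y₁ Y₂ : IntDCPO.{u}} {l : X₂ ⟶ Y₂} {κ : Y₁ ⊗ Y₂ ⟶ X₁ ⊗ X₂}
    {y : Y₁.pos} {s : X₁.neg} {x : X₁.pos} {r : Y₁.neg} :
    Hom.Rel (slash l κ) y s x r ↔ ∃ (y' : Y₂.pos) (s' : X₂.neg) (x' : X₂.pos) (r' : Y₂.neg),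
      Hom.Rel κ ((y, y') : Y₁.pos × Y₂.pos) ((s', s) : X₂.neg × X₁.neg)
        ((x, x') : X₁.pos × X₂.pos) ((r', r) : Y₂.neg × Y₁.neg) ∧ Hom.Rel l x' r' y' s' := by
  refine rel_tr.trans ⟨?_, ?_⟩
  · rintro ⟨u, v, h⟩
    obtain ⟨⟨x₁, x₂⟩, ⟨s₂, s₁⟩, h1, h2⟩ := rel_comp'.1 h
    obtain ⟨⟨p, q⟩, h2⟩ := (rel_tensor (f := 𝟙 X₁) (g := l)).1 h2
    exact ⟨u, s₂, x₂, v, h1.mono le_rfl ⟨le_rfl, q⟩ ⟨p, le_rfl⟩ le_rfl, h2⟩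
  · rintro ⟨y', s', x', r', h1, h2⟩
    exact ⟨y', r', rel_comp'.2 ⟨((x, x') : X₁.pos × X₂.pos), ((s', s) : X₂.neg × X₁.neg), h1,
      (rel_tensor (f := 𝟙 X₁) (g := l)).2 ⟨⟨le_rfl, le_rfl⟩, h2⟩⟩⟩

theorem rel_backslash {X₁ X₂ Y₁ Y₂ : IntDCPO.{u}} {l : X₁ ⟶ Y₁} {κ : Y₁ ⊗ Y₂ ⟶ X₁ ⊗ X₂}
    {y' : Y₂.pos} {s' : X₂.neg} {x' : X₂.pos} {r' : Y₂.neg} :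
    Hom.Rel (backslash l κ) y' s' x' r' ↔
      ∃ (y : Y₁.pos) (s : X₁.neg) (x : X₁.pos) (r : Y₁.neg),
      Hom.Rel κ ((y, y') : Y₁.pos × Y₂.pos) ((s', s) : X₂.neg × X₁.neg)
        ((x, x') : X₁.pos × X₂.pos) ((r', r) : Y₂.neg × Y₁.neg) ∧ Hom.Rel l x r y s :=
  rel_slash.trans (exists_congr fun _ => exists_congr fun _ => exists_congr fun _ =>
    exists_congr fun _ => and_congr_left'
      ((rel_wireIso_comp (h1 := fun _ => rfl) (h2 := fun _ => rfl) (h3 := fun _ => rfl)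
        (h4 := fun _ => rfl)).trans
      (rel_comp_wireIso (h1 := fun _ => rfl) (h2 := fun _ => rfl) (h3 := fun _ => rfl)
        (h4 := fun _ => rfl))))

theorem slash_comp_left {X₁ X₂ Y₁ Y₂ Z₁ Z₂ : IntDCPO.{u}} (g : X₂ ⟶ Y₂) (h₁ : Y₁ ⟶ Z₁)
    (h₂ : Y₂ ⟶ Z₂) (κ : Z₁ ⊗ Z₂ ⟶ X₁ ⊗ X₂) :
    slash g ((h₁ ⊗ₘ h₂) ≫ κ) = h₁ ≫ slash (g ≫ h₂) κ := Hom.ext_rel <| by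
  intro y s x r
  rw [rel_slash, rel_comp']
  constructor
  · rintro ⟨y', s', x', r', h, h'⟩
    obtain ⟨⟨z, z'⟩, ⟨q', q⟩, h1, h2⟩ := rel_comp'.1 h
    obtain ⟨h1, h3⟩ := rel_tensor.1 h1
    exact ⟨z, q, h1, rel_slash.2 ⟨z', s', x', q', h2, rel_comp'.2 ⟨y', r', h', h3⟩⟩⟩
  · rintro ⟨z, q, h1, h⟩
    obtain ⟨z', s', x', q', h2, h⟩ := rel_slash.1 h
    obtain ⟨y', r', h', h3⟩ := rel_comp'.1 h
    exact ⟨y', s', x', r', rel_comp'.2 ⟨((z, z') : Z₁.pos × Z₂.pos),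
      ((q', q) : Z₂.neg × Z₁.neg), rel_tensor.2 ⟨h1, h3⟩, h2⟩, h'⟩

theorem slash_comp_right {X₁ X₂ Y₁ Y₂ Z₁ Z₂ : IntDCPO.{u}} (g₁ : X₁ ⟶ Y₁) (g₂ : X₂ ⟶ Y₂)
    (h : Y₂ ⟶ Z₂) (κ : Z₁ ⊗ Z₂ ⟶ X₁ ⊗ X₂) :
    slash h (κ ≫ (g₁ ⊗ₘ g₂)) = slash (g₂ ≫ h) κ ≫ g₁ := Hom.ext_rel <| by
  intro z r y q
  rw [rel_slash, rel_comp']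
  constructor
  · rintro ⟨z', r', y', q', h1, h'⟩
    obtain ⟨⟨x, x'⟩, ⟨s', s⟩, h1, h2⟩ := rel_comp'.1 h1
    obtain ⟨h2, h3⟩ := rel_tensor.1 h2
    exact ⟨x, s, rel_slash.2 ⟨z', s', x', q', h1, rel_comp'.2 ⟨y', r', h3, h'⟩⟩, h2⟩
  · rintro ⟨x, s, h1, h2⟩
    obtain ⟨z', s', x', q', h1, h3⟩ := rel_slash.1 h1
    obtain ⟨y', r', h3, h'⟩ := rel_comp'.1 h3
    exact ⟨z', r', y', q', rel_comp'.2 ⟨((x, x') : X₁.pos × X₂.pos),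
      ((s', s) : X₂.neg × X₁.neg), h1, rel_tensor.2 ⟨h2, h3⟩⟩, h'⟩

theorem backslash_comp_left {X₁ X₂ Y₁ Y₂ Z₁ Z₂ : IntDCPO.{u}} (g : X₁ ⟶ Y₁) (h₁ : Y₁ ⟶ Z₁)
    (h₂ : Y₂ ⟶ Z₂) (κ : Z₁ ⊗ Z₂ ⟶ X₁ ⊗ X₂) :
    backslash g ((h₁ ⊗ₘ h₂) ≫ κ) = h₂ ≫ backslash (g ≫ h₁) κ := by
  rw [backslash, backslash, ← slash_comp_left]
  congr 1
  simp only [← Category.assoc, BraidedCategory.braiding_naturality]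

theorem backslash_comp_right {X₁ X₂ Y₁ Y₂ Z₁ Z₂ : IntDCPO.{u}} (g₁ : X₁ ⟶ Y₁) (g₂ : X₂ ⟶ Y₂)
    (h : Y₁ ⟶ Z₁) (κ : Z₁ ⊗ Z₂ ⟶ X₁ ⊗ X₂) :
    backslash h (κ ≫ (g₁ ⊗ₘ g₂)) = backslash (g₁ ≫ h) κ ≫ g₂ := by
  rw [backslash, backslash, ← slash_comp_right]
  congr 1
  simp only [Category.assoc, BraidedCategory.braiding_naturality]

theorem backslash_comp_braiding {X₁ X₂ Y₁ Y₂ : IntDCPO.{u}} (l : X₂ ⟶ Y₂)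
    (κ : Y₂ ⊗ Y₁ ⟶ X₁ ⊗ X₂) :
    backslash l (κ ≫ (β_ X₁ X₂).hom) = slash l ((β_ Y₁ Y₂).hom ≫ κ) := by
  simp [backslash]

theorem backslash_braiding_comp {X₁ X₂ Y₁ Y₂ : IntDCPO.{u}} (l : X₁ ⟶ Y₁)
    (κ : Y₂ ⊗ Y₁ ⟶ X₁ ⊗ X₂) :
    backslash l ((β_ Y₁ Y₂).hom ≫ κ) = slash l (κ ≫ (β_ X₁ X₂).hom) := by
  simp [backslash]

section assoc

variable {X₁ X₂ X₃ Y₁ Y₂ Y₃ : IntDCPO.{u}} (g₁ : X₁ ⟶ Y₁) (g₂ : X₂ ⟶ Y₂) (g₃ : X₃ ⟶ Y₃)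
  (κ : Y₁ ⊗ (Y₂ ⊗ Y₃) ⟶ (X₁ ⊗ X₂) ⊗ X₃)

theorem slash_slash_assoc :
    slash g₂ (slash g₃ ((α_ _ _ _).hom ≫ κ)) = slash (g₂ ⊗ₘ g₃) (κ ≫ (α_ _ _ _).hom) :=
  Hom.ext_rel <| by
  intro y s x r
  rw [rel_slash, rel_slash]
  constructor
  · rintro ⟨y', s', x', r', h, h2⟩
    obtain ⟨y'', s'', x'', r'', h, h3⟩ := rel_slash.1 h
    exact ⟨((y', y'') : Y₂.pos × Y₃.pos), ((s'', s') : X₃.neg × X₂.neg),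
      ((x', x'') : X₂.pos × X₃.pos), ((r'', r') : Y₃.neg × Y₂.neg),
      rel_comp_wireIso.2 (rel_wireIso_comp.1 h), rel_tensor.2 ⟨h2, h3⟩⟩
  · rintro ⟨⟨y', y''⟩, ⟨s'', s'⟩, ⟨x', x''⟩, ⟨r'', r'⟩, h, h'⟩
    obtain ⟨h2, h3⟩ := rel_tensor.1 h'
    exact ⟨y', s', x', r',
      rel_slash.2 ⟨y'', s'', x'', r'', rel_wireIso_comp.2 (rel_comp_wireIso.1 h), h3⟩, h2⟩

theorem backslash_slash_assoc :
    backslash g₁ (slash g₃ ((α_ _ _ _).hom ≫ κ)) = slash g₃ (backslash g₁ (κ ≫ (α_ _ _ _).hom)) :=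
  Hom.ext_rel <| by
  intro y' s' x' r'
  rw [rel_slash, rel_backslash]
  constructor
  · rintro ⟨y, s, x, r, h, h1⟩
    obtain ⟨y'', s'', x'', r'', h, h3⟩ := rel_slash.1 h
    exact ⟨y'', s'', x'', r'',
      rel_backslash.2 ⟨y, s, x, r, rel_comp_wireIso.2 (rel_wireIso_comp.1 h), h1⟩, h3⟩
  · rintro ⟨y'', s'', x'', r'', h, h3⟩
    obtain ⟨y, s, x, r, h, h1⟩ := rel_backslash.1 h
    exact ⟨y, s, x, r,
      rel_slash.2 ⟨y'', s'', x'', r'', rel_wireIso_comp.2 (rel_comp_wireIso.1 h), h3⟩, h1⟩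

theorem backslash_backslash_assoc :
    backslash (g₁ ⊗ₘ g₂) ((α_ _ _ _).hom ≫ κ) =
      backslash g₂ (backslash g₁ (κ ≫ (α_ _ _ _).hom)) :=
  Hom.ext_rel <| by
  intro y'' s'' x'' r''
  rw [rel_backslash, rel_backslash]
  constructor
  · rintro ⟨⟨y, y'⟩, ⟨s', s⟩, ⟨x, x'⟩, ⟨r', r⟩, h, h'⟩
    obtain ⟨h1, h2⟩ := rel_tensor.1 h'
    exact ⟨y', s', x', r',
      rel_backslash.2 ⟨y, s, x, r, rel_comp_wireIso.2 (rel_wireIso_comp.1 h), h1⟩, h2⟩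
  · rintro ⟨y', s', x', r', h, h2⟩
    obtain ⟨y, s, x, r, h, h1⟩ := rel_backslash.1 h
    exact ⟨((y, y') : Y₁.pos × Y₂.pos), ((s', s) : X₂.neg × X₁.neg),
      ((x, x') : X₁.pos × X₂.pos), ((r', r) : Y₂.neg × Y₁.neg),
      rel_wireIso_comp.2 (rel_comp_wireIso.1 h), rel_tensor.2 ⟨h1, h2⟩⟩

end assoc

theorem backslash_unit {X Y : IntDCPO.{u}} (κ : Y ⟶ 𝟙_ IntDCPO.{u} ⊗ X) :
    backslash (𝟙 (𝟙_ IntDCPO.{u})) ((λ_ Y).hom ≫ κ) = κ ≫ (λ_ X).hom := Hom.ext_rel <| by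
  intro y s x r
  rw [rel_backslash]
  refine Iff.trans ⟨?_, ?_⟩ rel_comp_wireIso.symm
  · rintro ⟨t1, t2, t3, t4, h, -⟩
    exact rel_wireIso_comp.1 h
  · intro h
    exact ⟨PUnit.unit, PUnit.unit, PUnit.unit, PUnit.unit, rel_wireIso_comp.2 h, trivial, trivial⟩

theorem slash_unit {X Y : IntDCPO.{u}} (κ : Y ⟶ X ⊗ 𝟙_ IntDCPO.{u}) :
    slash (𝟙 (𝟙_ IntDCPO.{u})) ((ρ_ Y).hom ≫ κ) = κ ≫ (ρ_ X).hom := Hom.ext_rel <| by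
  intro y s x r
  rw [rel_slash]
  refine Iff.trans ⟨?_, ?_⟩ rel_comp_wireIso.symm
  · rintro ⟨t1, t2, t3, t4, h, -⟩
    exact rel_wireIso_comp.1 h
  · intro h
    exact ⟨PUnit.unit, PUnit.unit, PUnit.unit, PUnit.unit, rel_wireIso_comp.2 h, trivial, trivial⟩

end IntDCPO

/-! ## Open games over `Int(DCPO)` -/

/-- An open game `A ⟶ B` over `Int(DCPO)`: a set of strategy profiles, a morphism of `Int(DCPO)` for
each profile, and a winning condition relating profiles and contexts. -/
structure OpenGame (A B : IntDCPO.{u}) : Type (u + 1) where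
  Profile : Type u
  label : Profile → (A ⟶ B)
  win : Profile → (B ⟶ A) → Prop

namespace OpenGame

variable {A B C A' B' : IntDCPO.{u}}

/-- Open games are identified along compatible bijections of strategy profiles. -/
instance setoid (A B : IntDCPO.{u}) : Setoid (OpenGame A B) where
  r G H := ∃ e : G.Profile ≃ H.Profile, (∀ σ, H.label (e σ) = G.label σ) ∧
    ∀ σ κ, H.win (e σ) κ ↔ G.win σ κ
  iseqv :=
    { refl := fun G => ⟨Equiv.refl _, fun _ => rfl, fun _ _ => Iff.rfl⟩
      symm := fun {G H} ⟨e, h1, h2⟩ => ⟨e.symm,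
        fun σ => by rw [← h1, e.apply_symm_apply],
        fun σ κ => by rw [← h2, e.apply_symm_apply]⟩
      trans := fun ⟨e, h1, h2⟩ ⟨e', h1', h2'⟩ => ⟨e.trans e',
        fun σ => (h1' _).trans (h1 σ), fun σ κ => (h2' _ κ).trans (h2 σ κ)⟩ }

theorem equiv_of {G H : OpenGame A B} (f : G.Profile → H.Profile) (g : H.Profile → G.Profile)
    (hgf : ∀ σ, g (f σ) = σ) (hfg : ∀ τ, f (g τ) = τ) (h1 : ∀ σ, H.label (f σ) = G.label σ)
    (h2 : ∀ σ κ, H.win (f σ) κ ↔ G.win σ κ) : G ≈ H :=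
  ⟨⟨f, g, hgf, hfg⟩, h1, h2⟩

/-- The zero-player open game on a morphism: one strategy profile, winning in every context. -/
def zeroPlayer (l : A ⟶ B) : OpenGame A B where
  Profile := PUnit
  label _ := l
  win _ _ := True

/-- Sequential composition: `G` sees the context precomposed with the morphism chosen in `H`, and
`H` sees it postcomposed with the morphism chosen in `G`. -/
noncomputable def comp (G : OpenGame A B) (H : OpenGame B C) : OpenGame A C where
  Profile := G.Profile × H.Profile
  label p := G.label p.1 ≫ H.label p.2
  win p κ := G.win p.1 (H.label p.2 ≫ κ) ∧ H.win p.2 (κ ≫ G.label p.1)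

/-- Simultaneous composition: each game sees the context closed by the morphism chosen in the
other. -/
noncomputable def tensor (G : OpenGame A B) (H : OpenGame A' B') :
    OpenGame (A ⊗ A') (B ⊗ B') where
  Profile := G.Profile × H.Profile
  label p := G.label p.1 ⊗ₘ H.label p.2
  win p κ := G.win p.1 (IntDCPO.slash (H.label p.2) κ) ∧
    H.win p.2 (IntDCPO.backslash (G.label p.1) κ)

theorem comp_congr {G G' : OpenGame A B} (h : G ≈ G') {H H' : OpenGame B C} (h' : H ≈ H') :
    G.comp H ≈ G'.comp H' := by
  obtain ⟨e, h1, h2⟩ := h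
  obtain ⟨e', h1', h2'⟩ := h'
  refine equiv_of (fun p => (e p.1, e' p.2)) (fun p => (e.symm p.1, e'.symm p.2))
    (fun p => by simp; rfl) (fun p => by simp; rfl) ?_ ?_
  · rintro ⟨σ, τ⟩
    simp [comp, h1, h1']
  · rintro ⟨σ, τ⟩ κ
    simp [comp, h1, h1', h2, h2']

theorem tensor_congr {G G' : OpenGame A B} (h : G ≈ G') {H H' : OpenGame A' B'} (h' : H ≈ H') :
    G.tensor H ≈ G'.tensor H' := by
  obtain ⟨e, h1, h2⟩ := h
  obtain ⟨e', h1', h2'⟩ := h'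
  refine equiv_of (fun p => (e p.1, e' p.2)) (fun p => (e.symm p.1, e'.symm p.2))
    (fun p => by simp; rfl) (fun p => by simp; rfl) ?_ ?_
  · rintro ⟨σ, τ⟩
    simp [tensor, h1, h1']
  · rintro ⟨σ, τ⟩ κ
    simp [tensor, h1, h1', h2, h2']

end OpenGame

/-- Objects of the category of open games over `Int(DCPO)`: the objects of `Int(DCPO)`. -/
structure OG : Type (u + 1) where
  base : IntDCPO.{u}

namespace OG

/-- Morphisms are open games up to compatible bijection of strategy profiles. -/
noncomputable instance : Category OG.{u} where
  Hom X Y := Quotient (OpenGame.setoid X.base Y.base)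
  id X := ⟦OpenGame.zeroPlayer (𝟙 X.base)⟧
  comp := Quotient.map₂ OpenGame.comp fun _ _ h _ _ h' => OpenGame.comp_congr h h'
  id_comp f := by
    induction f using Quotient.inductionOn with | _ G
    refine Quotient.sound (OpenGame.equiv_of (fun p => p.2) (fun p => (⟨⟩, p))
      (fun _ => rfl) (fun _ => rfl) ?_ ?_)
    · rintro ⟨_, σ⟩
      simp [OpenGame.comp, OpenGame.zeroPlayer]
    · rintro ⟨_, σ⟩ κ
      simp [OpenGame.comp, OpenGame.zeroPlayer]
  comp_id f := by
    induction f using Quotient.inductionOn with | _ G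
    refine Quotient.sound (OpenGame.equiv_of (fun p => p.1) (fun p => (p, ⟨⟩))
      (fun _ => rfl) (fun _ => rfl) ?_ ?_)
    · rintro ⟨σ, _⟩
      simp [OpenGame.comp, OpenGame.zeroPlayer]
    · rintro ⟨σ, _⟩ κ
      simp [OpenGame.comp, OpenGame.zeroPlayer]
  assoc f g h := by
    induction f, g, h using Quotient.inductionOn₃ with | _ F G H
    refine Quotient.sound (OpenGame.equiv_of (fun p => (p.1.1, (p.1.2, p.2))) (fun p => ((p.1, p.2.1), p.2.2))
      (fun _ => rfl) (fun _ => rfl) ?_ ?_)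
    · rintro ⟨⟨σ, τ⟩, υ⟩
      simp [OpenGame.comp]
    · rintro ⟨⟨σ, τ⟩, υ⟩ κ
      simp [OpenGame.comp, and_assoc]

/-- The zero-player functor from `Int(DCPO)` to open games. -/
noncomputable def zeroPlayer : IntDCPO.{u} ⥤ OG.{u} where
  obj A := ⟨A⟩
  map l := ⟦OpenGame.zeroPlayer l⟧
  map_id _ := rfl
  map_comp _ _ := Quotient.sound ⟨(Equiv.prodPUnit _).symm, fun _ => rfl, fun _ _ =>
    ⟨fun _ => trivial, fun _ => ⟨trivial, trivial⟩⟩⟩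

/-- Simultaneous composition of morphisms. -/
noncomputable def tensorHom {X Y X' Y' : OG.{u}} (f : X ⟶ Y) (g : X' ⟶ Y') :
    (⟨X.base ⊗ X'.base⟩ : OG.{u}) ⟶ ⟨Y.base ⊗ Y'.base⟩ :=
  Quotient.map₂ OpenGame.tensor (fun _ _ h _ _ h' => OpenGame.tensor_congr h h') f g

theorem tensorHom_zeroPlayer {A B A' B' : IntDCPO.{u}} (f : A ⟶ B) (g : A' ⟶ B') :
    tensorHom (zeroPlayer.map f) (zeroPlayer.map g) = zeroPlayer.map (f ⊗ₘ g) :=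
  Quotient.sound ⟨Equiv.prodPUnit _, fun _ => rfl, fun _ _ =>
    ⟨fun _ => ⟨trivial, trivial⟩, fun _ => trivial⟩⟩

noncomputable instance : MonoidalCategoryStruct OG.{u} where
  tensorObj X Y := ⟨X.base ⊗ Y.base⟩
  tensorHom := tensorHom
  whiskerLeft X _ _ f := tensorHom (𝟙 X) f
  whiskerRight f X := tensorHom f (𝟙 X)
  tensorUnit := ⟨𝟙_ IntDCPO⟩
  associator X Y Z := zeroPlayer.mapIso (α_ X.base Y.base Z.base)
  leftUnitor X := zeroPlayer.mapIso (λ_ X.base)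
  rightUnitor X := zeroPlayer.mapIso (ρ_ X.base)

noncomputable instance : MonoidalCategory OG.{u} :=
  MonoidalCategory.ofTensorHom
    (id_tensorHom_id := fun X Y =>
      (tensorHom_zeroPlayer (𝟙 X.base) (𝟙 Y.base)).trans
        (congrArg zeroPlayer.map (id_tensorHom_id _ _)))
    (id_tensorHom := fun _ _ _ _ => rfl)
    (tensorHom_id := fun _ _ => rfl)
    (tensorHom_comp_tensorHom := fun f₁ f₂ g₁ g₂ => by
      induction f₁, f₂ using Quotient.inductionOn₂ with | _ F₁ F₂
      induction g₁, g₂ using Quotient.inductionOn₂ with | _ G₁ G₂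
      refine Quotient.sound (OpenGame.equiv_of (fun p => ((p.1.1, p.2.1), (p.1.2, p.2.2))) (fun p => ((p.1.1, p.2.1), (p.1.2, p.2.2)))
      (fun _ => rfl) (fun _ => rfl) ?_ ?_)
      · rintro ⟨⟨σ₁, σ₂⟩, ⟨τ₁, τ₂⟩⟩
        simp [OpenGame.comp, OpenGame.tensor]
      · rintro ⟨⟨σ₁, σ₂⟩, ⟨τ₁, τ₂⟩⟩ κ
        simp [OpenGame.comp, OpenGame.tensor, IntDCPO.slash_comp_left, IntDCPO.slash_comp_right,
          IntDCPO.backslash_comp_left, IntDCPO.backslash_comp_right]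
        tauto)
    (associator_naturality := fun f₁ f₂ f₃ => by
      induction f₁, f₂, f₃ using Quotient.inductionOn₃ with | _ F₁ F₂ F₃
      refine Quotient.sound (OpenGame.equiv_of (fun p => (⟨⟩, (p.1.1.1, (p.1.1.2, p.1.2)))) (fun p => (((p.2.1, p.2.2.1), p.2.2.2), ⟨⟩))
      (fun _ => rfl) (fun _ => rfl) (fun _ => ?_) ?_)
      · exact (MonoidalCategory.associator_naturality _ _ _).symm
      · rintro ⟨⟨⟨σ₁, σ₂⟩, σ₃⟩, _⟩ κ
        simp [OpenGame.comp, OpenGame.tensor, OpenGame.zeroPlayer, IntDCPO.slash_slash_assoc,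
          IntDCPO.backslash_slash_assoc, IntDCPO.backslash_backslash_assoc, and_assoc])
    (leftUnitor_naturality := fun f => by
      induction f using Quotient.inductionOn with | _ F
      refine Quotient.sound (OpenGame.equiv_of (fun p => (⟨⟩, p.1.2)) (fun p => ((⟨⟩, p.2), ⟨⟩))
      (fun _ => rfl) (fun _ => rfl) (fun _ => ?_) ?_)
      · exact (MonoidalCategory.leftUnitor_naturality _).symm
      · rintro ⟨⟨_, σ⟩, _⟩ κ
        exact ⟨fun h => ⟨⟨trivial, (IntDCPO.backslash_unit κ).symm ▸ h.2⟩, trivial⟩,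
          fun h => ⟨trivial, IntDCPO.backslash_unit κ ▸ h.1.2⟩⟩)
    (rightUnitor_naturality := fun f => by
      induction f using Quotient.inductionOn with | _ F
      refine Quotient.sound (OpenGame.equiv_of (fun p => (⟨⟩, p.1.1)) (fun p => ((p.2, ⟨⟩), ⟨⟩))
      (fun _ => rfl) (fun _ => rfl) (fun _ => ?_) ?_)
      · exact (MonoidalCategory.rightUnitor_naturality _).symm
      · rintro ⟨⟨σ, _⟩, _⟩ κ
        exact ⟨fun h => ⟨⟨(IntDCPO.slash_unit κ).symm ▸ h.2, trivial⟩, trivial⟩,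
          fun h => ⟨trivial, IntDCPO.slash_unit κ ▸ h.1.1⟩⟩)
    (pentagon := fun W X Y Z => Quotient.sound
      ⟨⟨fun _ => (⟨⟩, ⟨⟩), fun _ => ((⟨⟩, ⟨⟩), (⟨⟩, (⟨⟩, ⟨⟩))), fun _ => rfl, fun _ => rfl⟩,
        fun _ => (MonoidalCategory.pentagon W.base X.base Y.base Z.base).symm,
        fun _ _ => ⟨fun _ => ⟨⟨trivial, trivial⟩, ⟨trivial, ⟨trivial, trivial⟩⟩⟩,
          fun _ => ⟨trivial, trivial⟩⟩⟩)
    (triangle := fun X Y => Quotient.sound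
      ⟨⟨fun _ => (⟨⟩, ⟨⟩), fun _ => (⟨⟩, (⟨⟩, ⟨⟩)), fun _ => rfl, fun _ => rfl⟩,
        fun _ => (MonoidalCategory.triangle X.base Y.base).symm,
        fun _ _ => ⟨fun _ => ⟨trivial, ⟨trivial, trivial⟩⟩, fun _ => ⟨trivial, trivial⟩⟩⟩)

theorem braiding_naturality_aux {X Y X' Y' : OG.{u}} (f : X ⟶ Y) (g : X' ⟶ Y') :
    tensorHom f g ≫ zeroPlayer.map (β_ Y.base Y'.base).hom =
      zeroPlayer.map (β_ X.base X'.base).hom ≫ tensorHom g f := by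
  induction f, g using Quotient.inductionOn₂ with | _ F G
  refine Quotient.sound (OpenGame.equiv_of (fun p => (⟨⟩, (p.1.2, p.1.1))) (fun p => ((p.2.2, p.2.1), ⟨⟩))
      (fun _ => rfl) (fun _ => rfl) (fun _ => ?_) ?_)
  · exact (BraidedCategory.braiding_naturality _ _).symm
  · rintro ⟨⟨σ, τ⟩, _⟩ κ
    have e₁ := congrArg (F.win σ) (IntDCPO.backslash_comp_braiding (G.label τ) κ)
    have e₂ := congrArg (G.win τ) (IntDCPO.backslash_braiding_comp (F.label σ) κ)
    exact ⟨fun h => ⟨⟨e₁.mp h.2.2, e₂.mpr h.2.1⟩, trivial⟩,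
      fun h => ⟨trivial, e₂.mp h.1.2, e₁.mpr h.1.1⟩⟩

noncomputable instance : SymmetricCategory OG.{u} where
  braiding X Y := zeroPlayer.mapIso (β_ X.base Y.base)
  braiding_naturality_right X _ _ f := braiding_naturality_aux (𝟙 X) f
  braiding_naturality_left f Z := braiding_naturality_aux f (𝟙 Z)
  hexagon_forward X Y Z := Quotient.sound
    ⟨⟨fun _ => ((⟨⟩, ⟨⟩), (⟨⟩, (⟨⟩, ⟨⟩))), fun _ => (⟨⟩, (⟨⟩, ⟨⟩)), fun _ => rfl, fun _ => rfl⟩,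
      fun _ => (BraidedCategory.hexagon_forward X.base Y.base Z.base).symm,
      fun _ _ => ⟨fun _ => ⟨trivial, ⟨trivial, trivial⟩⟩,
        fun _ => ⟨⟨trivial, trivial⟩, ⟨trivial, ⟨trivial, trivial⟩⟩⟩⟩⟩
  hexagon_reverse X Y Z := Quotient.sound
    ⟨⟨fun _ => ((⟨⟩, ⟨⟩), (⟨⟩, (⟨⟩, ⟨⟩))), fun _ => (⟨⟩, (⟨⟩, ⟨⟩)), fun _ => rfl, fun _ => rfl⟩,
      fun _ => (BraidedCategory.hexagon_reverse X.base Y.base Z.base).symm,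
      fun _ _ => ⟨fun _ => ⟨trivial, ⟨trivial, trivial⟩⟩,
        fun _ => ⟨⟨trivial, trivial⟩, ⟨trivial, ⟨trivial, trivial⟩⟩⟩⟩⟩
  symmetry X Y := (zeroPlayer.mapIso (β_ X.base Y.base)).hom_inv_id

/-- The dual of an open-game object: `(X, S)* = (S, X)`. -/
def dual (X : OG.{u}) : OG.{u} := ⟨X.base.dual⟩

end OG

/-- A compact closed structure on a symmetric monoidal category `C`, with duals `X* = dual X`: for each
object `X` a unit `I ⟶ X ⊗ X*` and a counit `X* ⊗ X ⟶ I` satisfying the two yanking equations. -/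
structure CompactClosed (C : Type*) [Category C] [MonoidalCategory C] [SymmetricCategory C]
    (dual : C → C) where
  pairing : ∀ X : C, ExactPairing X (dual X)

/-!
The zero-player functor `F : Int(DCPO) ⥤ OG` is strict symmetric monoidal: the coherence
isomorphisms of open games are by definition images of those of `Int(DCPO)`, and `F` commutes
with tensor products of morphisms (`OG.tensorHom_zeroPlayer`).  The yanking equations mention only
coherence isomorphisms, tensor products with identities, the unit and the counit, so those of
`Int(DCPO)` are carried by `F` to those of `OG`.
-/

namespace OG

theorem whiskerLeft_zeroPlayer (A : IntDCPO.{u}) {B C : IntDCPO.{u}} (f : B ⟶ C) :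
    zeroPlayer.obj A ◁ zeroPlayer.map f = zeroPlayer.map (A ◁ f) := by
  rw [← id_tensorHom A f]
  exact tensorHom_zeroPlayer (𝟙 A) f

theorem zeroPlayer_whiskerRight {A B : IntDCPO.{u}} (f : A ⟶ B) (C : IntDCPO.{u}) :
    zeroPlayer.map f ▷ zeroPlayer.obj C = zeroPlayer.map (f ▷ C) := by
  rw [← tensorHom_id f C]
  exact tensorHom_zeroPlayer f (𝟙 C)

/-- The image under the zero-player functor of the duality between `(X, S)` and `(S, X)`. -/
@[reducible]
noncomputable def exactPairing (X : OG.{u}) : ExactPairing X X.dual where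
  coevaluation' := zeroPlayer.map (η_ X.base X.base.dual)
  evaluation' := zeroPlayer.map (ε_ X.base X.base.dual)
  coevaluation_evaluation' := by
    have h := congrArg zeroPlayer.map (ExactPairing.coevaluation_evaluation X.base X.base.dual)
    simp only [Functor.map_comp, ← whiskerLeft_zeroPlayer, ← zeroPlayer_whiskerRight] at h
    exact h
  evaluation_coevaluation' := by
    have h := congrArg zeroPlayer.map (ExactPairing.evaluation_coevaluation X.base X.base.dual)
    simp only [Functor.map_comp, ← whiskerLeft_zeroPlayer, ← zeroPlayer_whiskerRight] at h
    exact h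

end OG

theorem mainTheorem1 :
    ∃ K : CompactClosed OG.{u} OG.dual, ∀ X : OG.{u},
      (K.pairing X).coevaluation' = OG.zeroPlayer.map (η_ X.base X.base.dual) ∧
      (K.pairing X).evaluation' = OG.zeroPlayer.map (ε_ X.base X.base.dual) :=
  ⟨⟨OG.exactPairing⟩, fun _ => ⟨rfl, rfl⟩⟩
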